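/- For a real $m\times k$ matrix $E$, let $B_1\subset\mathbb R^k$ be the closed Euclidean unit ball and, for an integer $L\ge 2$, $$\mathscr D_{\mathrm a}(E,L):=\inf_{\mathscr A\subset\mathbb R,\ |\mathscr A|=L}\ \ \inf_{F\in\mathbb R^{k\times m},\ FE=I}\ \ \sup_{x\in B_1}\ \inf_{q\in\mathscr A^m}\|x-Fq\|_2\in[0,\infty].$$ For $\beta>1$, $\delta>0$ and an integer $1\le l\le m$, put $s=\lfloor m/l\rfloor$ and split the indices $0,\dots,m-1$ into consecutive blocks, the block of $i$ being $\lfloor i/s\rfloor$. Let $H$ be the block diagonal $m\times m$ matrix that in each block has $1$ on the diagonal and $-\beta$ on the subdiagonal. Let $\mathscr A_{L,\delta}=\{(2i-(L-1))\delta: 0\le i<L\}$. The greedy beta quantizer $Q_{L,l,\beta,\delta}:\mathbb R^m\to\mathscr A_{L,\delta}^m$ is $y\mapsto q$, where recursively $w_n=y_n-\sum_{j<n}H_{nj}u_j$, $q_n$ is $w_n$ rounded to a nearest element of $\mathscr A_{L,\delta}$ (a tie between two elements goes to the larger one), and $u_n=w_n-q_n$. Let $V$ be the $l\times m$ matrix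 with entries $V_{b,i}=\beta^{-((i\bmod s)+1)}$ if $\lfloor i/s\rfloor=b$ and $0$ otherwise ($0\le b<l$), and let $F_{l,\beta}(E)=(VE)^\dagger V$, with $A^\dagger=(A^{\top}A)^{-1}A^{\top}$, be the beta dual of $E$. **Theorem.** There are absolute constants $c_1,c_2>0$ with the following property. Let $\eta\in(0,1/2]$ and let $k,m$ be positive integers with $k\ge 8/\eta$, $m\ge 2k$ and $\frac mk\ge\frac{c_1}{\eta^2}\log\frac mk$. Then there are an integer $l$ with $k\le l\le m$, a number $\mu>0$ and, for every integer $L\ge 2$, numbers $\beta_L>1$, $\delta_L>0$ with $\beta_L+\mu/\delta_L\le L$, all depending only on $\eta,k,m$ (and $L$), such that for an $m\times k$ random matrix $E$ with independent standard Gaussian entries the following hold simultaneously with probability at least $1-\exp(-c_2\eta^2m)$: $\|Ex\|_\infty\le\mu$ for all $x\in B_1$, and for all integers $L\ge2$ $$\mathscr D_{\mathrm a}(E,L)\le\sqrt k\,L^{-(1-\eta)m/k}.$$ Moreover the bound is achieved constructively, by greedy beta quantization together with a beta dual: on the same event, for all integers $L\ge2$, the matrix $F_L=F_{l,\beta_L}(E)$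 satisfies $F_LE=I$ and $$\sup_{x\in B_1}\bigl\|x-F_L\,Q_{L,l,\beta_L,\delta_L}(Ex)\bigr\|_2\le\sqrt k\,L^{-(1-\eta)m/k}.$$ -/

import Mathlib

open MeasureTheory ProbabilityTheory
open scoped ENNReal

namespace FrameQuantization

noncomputable section

/-- The closed unit ball of `ℝ^k` for the Euclidean norm. -/
def unitBall (k : ℕ) : Set (EuclideanSpace ℝ (Fin k)) := Metric.closedBall 0 1

/-- The frame measurements `E x`. -/
def analyze {m k : ℕ} (E : Matrix (Fin m) (Fin k) ℝ) (x : EuclideanSpace ℝ (Fin k)) :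
    Fin m → ℝ :=
  E.mulVec x.ofLp

/-- The linear combination `F q = ∑ i, q i • f i` of the columns of `F`. -/
def synthesize {m k : ℕ} (F : Matrix (Fin k) (Fin m) ℝ) (q : Fin m → ℝ) :
    EuclideanSpace ℝ (Fin k) :=
  WithLp.toLp 2 (F.mulVec q)

/-- Synthesis distortion
`D_s(F, A, X) = sup_{x ∈ X} inf_{q ∈ A^m} ‖x - F q‖₂`, with values in `[0, ∞]`. -/
def synthesisDistortion {m k : ℕ} (F : Matrix (Fin k) (Fin m) ℝ) (A : Finset ℝ)
    (X : Set (EuclideanSpace ℝ (Fin k))) : ℝ≥0∞ :=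
  ⨆ x ∈ X, ⨅ (q : Fin m → ℝ) (_ : ∀ i, q i ∈ A), ‖x - synthesize F q‖ₑ

/-- Analysis distortion `D_a(E, A, X) = inf {D_s(F, A, X) : F E = I}`
(equal to `∞` if `E` has no dual, i.e. is not a frame). -/
def analysisDistortionOn {m k : ℕ} (E : Matrix (Fin m) (Fin k) ℝ) (A : Finset ℝ)
    (X : Set (EuclideanSpace ℝ (Fin k))) : ℝ≥0∞ :=
  ⨅ (F : Matrix (Fin k) (Fin m) ℝ) (_ : F * E = 1), synthesisDistortion F A X

/-- `D_a(E, L)`: the best analysis distortion on the unit ball over all alphabets of size `L`. -/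
def analysisDistortion {m k : ℕ} (E : Matrix (Fin m) (Fin k) ℝ) (L : ℕ) : ℝ≥0∞ :=
  ⨅ (A : Finset ℝ) (_ : A.card = L), analysisDistortionOn E A (unitBall k)

/-- `D(E, Q, F, X) = sup_{x ∈ X} ‖x - F Q(E x)‖₂`, the distortion of the scheme that measures
with `E`, quantizes with `Q` and reconstructs with `F`. -/
def schemeDistortion {m k : ℕ} (E : Matrix (Fin m) (Fin k) ℝ)
    (Q : (Fin m → ℝ) → (Fin m → ℝ)) (F : Matrix (Fin k) (Fin m) ℝ)
    (X : Set (EuclideanSpace ℝ (Fin k))) : ℝ≥0∞ :=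
  ⨆ x ∈ X, ‖x - synthesize F (Q (analyze E x))‖ₑ

/-- `E` is an `m × k` random matrix with independent standard Gaussian entries. -/
structure IsStandardGaussianFrame {Ω : Type*} [MeasurableSpace Ω] (P : Measure Ω) {m k : ℕ}
    (E : Ω → Matrix (Fin m) (Fin k) ℝ) : Prop where
  hasLaw : ∀ i j, HasLaw (fun ω => E ω i j) (gaussianReal 0 1) P
  indep : iIndepFun (fun (p : Fin m × Fin k) ω => E ω p.1 p.2) P

/-! ### Greedy quantization -/

/-- The arithmetic progression of length `L`, spacing `2 δ`, symmetric about `0`. -/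
def arithAlphabet (L : ℕ) (δ : ℝ) : Finset ℝ :=
  (Finset.range L).image fun i : ℕ => (2 * (i : ℝ) - ((L : ℝ) - 1)) * δ

/-- The index in `{0, …, L - 1}` of the element of `arithAlphabet L δ` nearest to `w`. -/
def roundIndex (L : ℕ) (δ w : ℝ) : ℤ :=
  max 0 (min ((L : ℤ) - 1) ⌊(w / δ + L) / 2⌋)

/-- Rounding to the nearest element of `arithAlphabet L δ`. -/
def roundArith (L : ℕ) (δ w : ℝ) : ℝ :=
  (2 * (roundIndex L δ w : ℝ) - ((L : ℝ) - 1)) * δ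

theorem roundArith_mem {L : ℕ} (hL : 1 ≤ L) (δ w : ℝ) :
    roundArith L δ w ∈ arithAlphabet L δ := by
  have h0 : 0 ≤ roundIndex L δ w := le_max_left _ _
  have h1 : roundIndex L δ w ≤ (L : ℤ) - 1 :=
    max_le (by omega) (min_le_left _ _)
  obtain ⟨n, hn⟩ := Int.eq_ofNat_of_zero_le h0
  refine Finset.mem_image.2 ⟨n, Finset.mem_range.2 (by omega), ?_⟩
  simp [roundArith, hn]

theorem roundArith_nearest {L : ℕ} {δ : ℝ} (hδ : 0 < δ) (w : ℝ) {a : ℝ}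
    (ha : a ∈ arithAlphabet L δ) : |w - roundArith L δ w| ≤ |w - a| := by
  obtain ⟨i, hi, rfl⟩ := Finset.mem_image.1 ha
  rw [Finset.mem_range] at hi
  obtain ⟨t, rfl⟩ : ∃ t, w = (2 * t - L) * δ := ⟨(w / δ + L) / 2, by field_simp; ring⟩
  have ht : ((2 * t - L) * δ / δ + L) / 2 = t := by field_simp; ring
  unfold roundArith roundIndex
  rw [ht]
  set z : ℤ := ⌊t⌋ with hz
  have hz1 : (z : ℝ) ≤ t := Int.floor_le t
  have hz2 : t < z + 1 := Int.lt_floor_add_one t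
  have key : ∀ s : ℝ, (2 * t - L) * δ - (2 * s - ((L : ℝ) - 1)) * δ = (2 * (t - s) - 1) * δ := by
    intro s; ring
  rw [key, key, abs_mul, abs_mul]
  refine mul_le_mul_of_nonneg_right ?_ (abs_nonneg δ)
  have hi' : (i : ℤ) ≤ (L : ℤ) - 1 := by omega
  have hi0 : (0 : ℤ) ≤ i := by omega
  rcases le_total z 0 with h | h
  · have e : max 0 (min ((L : ℤ) - 1) z) = 0 := by omega
    rw [e]
    rcases Nat.eq_zero_or_pos i with h' | h'
    · simp [h']
    · have h1 : (1 : ℝ) ≤ i := by exact_mod_cast h'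
      have h2 : (z : ℝ) ≤ 0 := by exact_mod_cast h
      rw [abs_of_nonpos (a := 2 * (t - i) - 1) (by linarith)]
      push_cast
      exact abs_le.2 ⟨by linarith, by linarith⟩
  · rcases le_total ((L : ℤ) - 1) z with h' | h'
    · have e : max 0 (min ((L : ℤ) - 1) z) = (L : ℤ) - 1 := by omega
      rw [e]
      rcases eq_or_lt_of_le hi' with h3 | h3
      · rw [← h3]; simp
      · have h4 : (i : ℝ) + 1 ≤ (L : ℝ) - 1 := by
          have : (i : ℤ) + 1 ≤ (L : ℤ) - 1 := h3
          exact_mod_cast this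
        have h5 : (L : ℝ) - 1 ≤ z := by exact_mod_cast h'
        push_cast
        rw [abs_of_nonneg (a := 2 * (t - i) - 1) (by linarith)]
        exact abs_le.2 ⟨by linarith, by linarith⟩
    · have e : max 0 (min ((L : ℤ) - 1) z) = z := by omega
      rw [e]
      rcases lt_trichotomy (i : ℤ) z with h3 | h3 | h3
      · have h4 : (i : ℝ) + 1 ≤ z := by exact_mod_cast h3
        rw [abs_of_nonneg (a := 2 * (t - i) - 1) (by linarith)]
        exact abs_le.2 ⟨by linarith, by linarith⟩
      · rw [← h3]; simp
      · have h4 : (z : ℝ) + 1 ≤ i := by exact_mod_cast h3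
        rw [abs_of_nonpos (a := 2 * (t - i) - 1) (by linarith)]
        exact abs_le.2 ⟨by linarith, by linarith⟩

/-- The state sequence `u` of the greedy quantizer with rounding rule `r` and noise transfer
operator `H = I - H'` (`H'` strictly lower triangular, so `H' n j = - H n j` for `j < n`):
`u n = w n - r (w n)` with `w n = y n + ∑_{j < n} H' n j * u j`. -/
def greedyState {m : ℕ} (r : ℝ → ℝ) (H : Matrix (Fin m) (Fin m) ℝ) (y : Fin m → ℝ)
    (n : Fin m) : ℝ :=
  (y n - ∑ j : {j : Fin m // j < n}, H n j * greedyState r H y j) -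
    r (y n - ∑ j : {j : Fin m // j < n}, H n j * greedyState r H y j)
termination_by n
decreasing_by all_goals exact j.2

/-- The output `q n = r (y n + ∑_{j < n} H' n j * u j)` of the greedy quantizer. -/
def greedyQuantizer {m : ℕ} (r : ℝ → ℝ) (H : Matrix (Fin m) (Fin m) ℝ) (y : Fin m → ℝ)
    (n : Fin m) : ℝ :=
  r (y n - ∑ j : {j : Fin m // j < n}, H n j * greedyState r H y j)

/-! ### Beta noise shaping and beta duals

The rows `0, …, m - 1` are cut into consecutive blocks of length `s` (row `i` lies in block
`i / s`); rows beyond the first `l * s` ones are not used in the reconstruction. -/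

/-- The block diagonal noise transfer operator: in each block it is the bidiagonal matrix with
`1` on the diagonal and `-β` on the subdiagonal. -/
def betaTransfer (m s : ℕ) (β : ℝ) : Matrix (Fin m) (Fin m) ℝ :=
  Matrix.of fun i j =>
    if i = j then 1
    else if i.val = j.val + 1 ∧ i.val / s = j.val / s then -β
    else 0

/-- The block diagonal `l × m` matrix whose blocks are the rows `[β⁻¹ β⁻² ⋯ β⁻ˢ]`. -/
def betaCondensation (m s l : ℕ) (β : ℝ) : Matrix (Fin l) (Fin m) ℝ :=
  Matrix.of fun b i => if i.val / s = b.val then (β⁻¹) ^ (i.val % s + 1) else 0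

/-- The `V`-dual `(V E)^† V` of `E`, with `A^† = (Aᵀ A)⁻¹ Aᵀ`. -/
def vDual {m k l : ℕ} (V : Matrix (Fin l) (Fin m) ℝ) (E : Matrix (Fin m) (Fin k) ℝ) :
    Matrix (Fin k) (Fin m) ℝ :=
  ((V * E).transpose * (V * E))⁻¹ * (V * E).transpose * V

/-- The greedy beta quantizer with `l` blocks of length `⌊m / l⌋` and alphabet
`arithAlphabet L δ`. -/
def betaQuantizer (m l : ℕ) (β : ℝ) (L : ℕ) (δ : ℝ) : (Fin m → ℝ) → (Fin m → ℝ) :=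
  greedyQuantizer (roundArith L δ) (betaTransfer m (m / l) β)

/-- The beta dual of `E` with `l` blocks of length `⌊m / l⌋`. -/
def betaDual {m k : ℕ} (l : ℕ) (β : ℝ) (E : Matrix (Fin m) (Fin k) ℝ) :
    Matrix (Fin k) (Fin m) ℝ :=
  vDual (betaCondensation m (m / l) l β) E

/-- The set `S_{μ,L}` of admissible parameters `(β, δ)`, for which the greedy beta quantizer is
stable on inputs bounded by `μ`. -/
def admissible (μ : ℝ) (L : ℕ) : Set (ℝ × ℝ) :=
  {p | 1 < p.1 ∧ 0 < p.2 ∧ p.1 + μ / p.2 ≤ L}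

end

end FrameQuantization

open FrameQuantization

namespace FrameQuantization

/-! ### Stability and error of the greedy beta quantizer -/

/-! Deterministic side. Admissibility `β + μ/δ ≤ L` keeps the greedy state `u` bounded by `δ`, and
the quantization error is `y - q = Hu`. The geometric rows of `V` telescope against `H`, so `VH` has
a single entry `β⁻ˢ` in each row. Since `F = (VE)^† V` is a dual of `E`, `x - Fq = (VE)^† VHu` has
norm at most `√l β⁻ˢ δ / σ_min(VE)` (`schemeDistortion_betaQuantizer_le`).

Random side. The rows of `V` are orthogonal with norms at least `β⁻¹`. Normalising them gives `W`
with `σ_min(VE) ≥ β⁻¹ σ_min(WE)`, where `WEx` is a standard Gaussian vector in `ℝ^l` for each unit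
`x`. A net argument bounds the probability of `σ_min(WE) < ε√l` by roughly `ε^(l-k)` times `C^k`,
with `C` polynomial in `ρ = m/k` (`IsStandardGaussianFrame.measure_not_le_norm_mulVec_le`). Slightly
more blocks than `k` therefore suffice.

Balance. With `l ≈ (1 + η/4) k` blocks, the block length `s` still exceeds `(1 - η)ρ` by `ηρ/2`.
Half of this surplus pays for `ε = L^(-ηρ/4)`, and the other half absorbs factors polynomial in `ρ`.
The failure probability for one `L` is then at most `L^(-η²m/32)`. This is summable, so one event
serves every `L`. -/

theorem abs_sub_roundArith_le {L : ℕ} {δ w : ℝ} (hL : 1 ≤ L) (hδ : 0 < δ)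
    (hw : |w| ≤ L * δ) : |w - roundArith L δ w| ≤ δ := by
  obtain ⟨t, rfl⟩ : ∃ t, w = (2 * t - L) * δ := ⟨(w / δ + L) / 2, by field_simp; ring⟩
  have ht : ((2 * t - L) * δ / δ + L) / 2 = t := by field_simp; ring
  unfold roundArith roundIndex
  rw [ht]
  rw [abs_mul, abs_of_pos hδ, mul_le_mul_iff_left₀ hδ, abs_le] at hw
  have key : ∀ s : ℝ, (2 * t - L) * δ - (2 * s - ((L : ℝ) - 1)) * δ = (2 * (t - s) - 1) * δ := by
    intro s; ring
  rw [key, abs_mul, abs_of_pos hδ]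
  have h0 : (0 : ℤ) ≤ ⌊t⌋ := Int.floor_nonneg.2 (by linarith)
  have hz1 : (⌊t⌋ : ℝ) ≤ t := Int.floor_le t
  have hz2 : t < ⌊t⌋ + 1 := Int.lt_floor_add_one t
  suffices h : |2 * (t - ((max 0 (min ((L : ℤ) - 1) ⌊t⌋) : ℤ) : ℝ)) - 1| ≤ 1 from
    (mul_le_mul_of_nonneg_right h hδ.le).trans_eq (one_mul δ)
  rcases le_total ⌊t⌋ ((L : ℤ) - 1) with h | h
  · rw [min_eq_right h, max_eq_right h0]
    exact abs_le.2 ⟨by linarith, by linarith⟩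
  · rw [min_eq_left h, max_eq_right (by omega)]
    have h' : ((L : ℝ) - 1) ≤ ⌊t⌋ := by exact_mod_cast h
    push_cast
    exact abs_le.2 ⟨by linarith, by linarith⟩

theorem sum_betaTransfer_mul {m s : ℕ} (β : ℝ) (u : Fin m → ℝ) (n : Fin m) :
    (∑ j : {j : Fin m // j < n}, betaTransfer m s β n j * u j) =
      ∑ j, betaTransfer m s β n j * u j - u n := by
  have h1 : (∑ j : {j : Fin m // j < n}, betaTransfer m s β n j * u j) =
      ∑ j ∈ Finset.univ.filter (· < n), betaTransfer m s β n j * u j :=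
    (Finset.sum_subtype (Finset.univ.filter (· < n)) (by simp)
      (fun j => betaTransfer m s β n j * u j)).symm
  have h2 : (∑ j ∈ Finset.univ.filter (fun j => ¬ j < n), betaTransfer m s β n j * u j) = u n := by
    rw [Finset.sum_eq_single n]
    · simp [betaTransfer]
    · intro j hj hjn
      have : n < j := lt_of_le_of_ne (by simpa using hj) (Ne.symm hjn)
      have h3 : ¬ (n = j) := fun h => hjn h.symm
      have h4 : ¬ (n.val = j.val + 1) := by have : n.val < j.val := this; omega
      simp [betaTransfer, h3, h4]
    · simp
  rw [h1, ← Finset.sum_filter_add_sum_filter_not Finset.univ (· < n), h2, add_sub_cancel_right]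

/-- The recursion reads `u = y - (H - I)u - q`, because `H` is lower triangular with unit diagonal.
-/
theorem sub_greedyQuantizer_betaTransfer {m s : ℕ} (r : ℝ → ℝ) (β : ℝ) (y : Fin m → ℝ) :
    y - greedyQuantizer r (betaTransfer m s β) y =
      (betaTransfer m s β).mulVec (greedyState r (betaTransfer m s β) y) := by
  ext n
  have h := sum_betaTransfer_mul (s := s) β (greedyState r (betaTransfer m s β) y) n
  have hu := greedyState.eq_1 r (betaTransfer m s β) y n
  rw [Pi.sub_apply, greedyQuantizer, Matrix.mulVec, dotProduct]
  linarith

theorem abs_sum_betaTransfer_le {m s : ℕ} {β δ : ℝ} (hβ : 0 ≤ β) (hδ : 0 ≤ δ) {u : Fin m → ℝ}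
    (n : Fin m) (hu : ∀ j < n, |u j| ≤ δ) :
    |∑ j : {j : Fin m // j < n}, betaTransfer m s β n j * u j| ≤ β * δ := by
  rcases Nat.eq_zero_or_pos n.val with h | h
  · have : IsEmpty {j : Fin m // j < n} := ⟨fun j => by
      have : j.1.val < n.val := j.2
      omega⟩
    simp only [Finset.univ_eq_empty, Finset.sum_empty, abs_zero]
    positivity
  · let p : {j : Fin m // j < n} := ⟨⟨n.val - 1, by omega⟩, by
      change n.val - 1 < n.val; omega⟩
    rw [Finset.sum_eq_single p]
    · rw [abs_mul]
      refine mul_le_mul ?_ (hu _ p.2) (abs_nonneg _) hβ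
      simp only [betaTransfer, Matrix.of_apply]
      rw [if_neg (fun h => (ne_of_gt p.2) h)]
      split_ifs <;> simp [abs_of_nonneg hβ, hβ]
    · intro j _ hj
      have h1 : ¬ (n = j.1) := fun h => (ne_of_gt j.2) h
      have h2 : ¬ (n.val = j.1.val + 1) := fun h => hj (by
        apply Subtype.ext; apply Fin.ext; simp only [p]; omega)
      simp [betaTransfer, h1, h2]
    · simp

/-- Stability by strong induction: only one earlier state enters `w n`, so `|w n| ≤ μ + βδ ≤ Lδ` and
the rounding does not overload. -/
theorem abs_greedyState_le {m s L : ℕ} {β δ μ : ℝ} (hL : 1 ≤ L) (h : (β, δ) ∈ admissible μ L)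
    {y : Fin m → ℝ} (hy : ∀ i, |y i| ≤ μ) (n : Fin m) :
    |greedyState (roundArith L δ) (betaTransfer m s β) y n| ≤ δ := by
  obtain ⟨hβ, hδ, hadm⟩ := h
  simp only at hβ hδ hadm
  induction n using WellFoundedLT.induction with
  | ind n ih =>
    rw [greedyState]
    refine abs_sub_roundArith_le hL hδ ((abs_sub _ _).trans ?_)
    have h1 := abs_sum_betaTransfer_le (s := s) (by linarith : 0 ≤ β) hδ.le n ih
    have h2 : (β + μ / δ) * δ ≤ L * δ := mul_le_mul_of_nonneg_right hadm hδ.le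
    have h3 : (β + μ / δ) * δ = β * δ + μ := by field_simp
    linarith [hy n]

/-- Telescoping: at position `p` of a block the column of `H` contributes `β^-(p+1) - β · β^-(p+2) =
0`. The last position has no successor inside the block, so its first term survives. -/
theorem betaCondensation_mul_betaTransfer {m l : ℕ} {β : ℝ} (hβ : 0 < β) (hl : 0 < l)
    (hlm : l ≤ m) (b : Fin l) (j : Fin m) :
    (betaCondensation m (m / l) l β * betaTransfer m (m / l) β) b j =
      if j.val = b.val * (m / l) + (m / l - 1) then (β⁻¹) ^ (m / l) else 0 := by
  set s := m / l with hs
  have hs0 : 0 < s := Nat.div_pos hlm hl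
  have hls : (b.val + 1) * s ≤ m :=
    (Nat.mul_le_mul_right s b.2).trans (Nat.mul_div_le m l)
  have hdm := Nat.div_add_mod j.val s
  have hml := Nat.mod_lt j.val hs0
  rw [Matrix.mul_apply]
  have hterm : ∀ i : Fin m, i ≠ j → ¬ (i.val = j.val + 1 ∧ i.val / s = j.val / s) →
      betaCondensation m s l β b i * betaTransfer m s β i j = 0 := by
    intro i h1 h2
    simp [betaTransfer, h1, h2]
  have hjj : betaTransfer m s β j j = 1 := by simp [betaTransfer]
  by_cases hb : j.val / s = b.val
  · by_cases hlast : j.val % s + 1 = s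
    · rw [if_pos (by rw [← hb, mul_comm]; omega), Finset.sum_eq_single j, hjj]
      · simp [betaCondensation, hb, hlast]
      · intro i _ hi
        refine hterm i hi ?_
        rintro ⟨h1, h2⟩
        have h3 := Nat.div_add_mod i.val s
        have h4 := Nat.mod_lt i.val hs0
        rw [h2] at h3
        omega
      · simp
    · have hj1 : j.val + 1 = s * b.val + (j.val % s + 1) := by rw [← hb]; omega
      have hlt : j.val + 1 < m := by
        rw [add_mul, one_mul, mul_comm] at hls
        omega
      have hdiv : (j.val + 1) / s = b.val := by
        rw [hj1, Nat.mul_add_div hs0, Nat.div_eq_of_lt (by omega), add_zero]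
      have hmod : (j.val + 1) % s = j.val % s + 1 := by
        rw [hj1, Nat.mul_add_mod, Nat.mod_eq_of_lt (by omega)]
      let i' : Fin m := ⟨j.val + 1, hlt⟩
      have hne : j ≠ i' := fun h => by
        have := congrArg Fin.val h
        simp [i'] at this
      rw [if_neg (by rw [← hb, mul_comm]; omega)]
      rw [← Finset.sum_subset (Finset.subset_univ ({j, i'} : Finset (Fin m)))]
      · rw [Finset.sum_pair hne, hjj]
        have h1 : betaTransfer m s β i' j = -β := by
          simp [betaTransfer, hne.symm, i', hdiv, hb]
        have h2 : betaCondensation m s l β b j = (β⁻¹) ^ (j.val % s + 1) := by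
          simp [betaCondensation, hb]
        have h3 : betaCondensation m s l β b i' = (β⁻¹) ^ (j.val % s + 1 + 1) := by
          simp only [betaCondensation, Matrix.of_apply, i', hdiv, hmod, if_true]
        rw [h1, h2, h3, pow_succ _ (j.val % s + 1)]
        field_simp
        ring
      · intro i _ hi
        simp only [Finset.mem_insert, Finset.mem_singleton, not_or] at hi
        exact hterm i hi.1 fun h => hi.2 (Fin.ext h.1)
  -- Nonzero entries of `H` stay inside one block, so a column outside block `b` never meets the
  -- support of row `b` of `V`.
  · rw [if_neg, Finset.sum_eq_zero]
    · intro i _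
      by_cases h : betaTransfer m s β i j = 0
      · rw [h, mul_zero]
      · have : i.val / s = j.val / s := by
          by_contra h'
          exact h (by
            have : i ≠ j := fun e => h' (by rw [e])
            simp [betaTransfer, this, h'])
        rw [← this] at hb
        simp [betaCondensation, hb]
    · intro h
      apply hb
      rw [h, mul_comm, Nat.mul_add_div hs0, Nat.div_eq_of_lt (by omega), add_zero]

theorem norm_betaCondensation_betaTransfer_le {m l : ℕ} {β δ : ℝ} (hβ : 0 < β) (hl : 0 < l)
    (hlm : l ≤ m) (hδ : 0 ≤ δ) {u : Fin m → ℝ} (hu : ∀ i, |u i| ≤ δ) :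
    ‖(WithLp.toLp 2 ((betaCondensation m (m / l) l β).mulVec
      ((betaTransfer m (m / l) β).mulVec u)) : EuclideanSpace ℝ (Fin l))‖ ≤
      √l * ((β⁻¹) ^ (m / l) * δ) := by
  have hs0 : 0 < m / l := Nat.div_pos hlm hl
  have hβ' : 0 ≤ (β⁻¹) ^ (m / l) := by positivity
  have hcoord : ∀ b : Fin l, |((betaCondensation m (m / l) l β).mulVec
      ((betaTransfer m (m / l) β).mulVec u)) b| ≤ (β⁻¹) ^ (m / l) * δ := by
    intro b
    rw [Matrix.mulVec_mulVec, Matrix.mulVec, dotProduct]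
    simp only [betaCondensation_mul_betaTransfer hβ hl hlm]
    have hls : (b.val + 1) * (m / l) ≤ m :=
      (Nat.mul_le_mul_right _ b.2).trans (Nat.mul_div_le m l)
    rw [add_mul, one_mul] at hls
    rw [Finset.sum_eq_single ⟨b.val * (m / l) + (m / l - 1), by omega⟩]
    · rw [if_pos rfl, abs_mul, abs_of_nonneg hβ']
      exact mul_le_mul_of_nonneg_left (hu _) hβ'
    · intro j _ hj
      rw [if_neg (fun h => hj (Fin.ext h)), zero_mul]
    · simp
  rw [EuclideanSpace.norm_eq]
  calc √(∑ b, ‖_‖ ^ 2) ≤ √(∑ _b : Fin l, ((β⁻¹) ^ (m / l) * δ) ^ 2) := by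
        refine Real.sqrt_le_sqrt (Finset.sum_le_sum fun b _ => ?_)
        exact pow_le_pow_left₀ (norm_nonneg _) (hcoord b) 2
    _ = √l * ((β⁻¹) ^ (m / l) * δ) := by
        rw [Finset.sum_const, Finset.card_univ, Fintype.card_fin, nsmul_eq_mul, Real.sqrt_mul
          (Nat.cast_nonneg l), Real.sqrt_sq (by positivity)]

/-! ### Bounded-below matrices and their pseudo-inverses -/

theorem norm_sq_toLp {n : ℕ} (x : Fin n → ℝ) :
    ‖(WithLp.toLp 2 x : EuclideanSpace ℝ (Fin n))‖ ^ 2 = dotProduct x x := by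
  rw [EuclideanSpace.norm_sq_eq]
  simp [dotProduct, sq]

theorem dotProduct_le_norm_mul_norm {n : ℕ} (x y : Fin n → ℝ) :
    dotProduct x y ≤ ‖(WithLp.toLp 2 x : EuclideanSpace ℝ (Fin n))‖ *
      ‖(WithLp.toLp 2 y : EuclideanSpace ℝ (Fin n))‖ := by
  refine le_trans (le_of_eq ?_) (real_inner_le_norm _ _)
  simp [PiLp.inner_apply, dotProduct, mul_comm]

theorem isUnit_det_transpose_mul_self {l k : ℕ} {A : Matrix (Fin l) (Fin k) ℝ} {σ : ℝ}
    (hσ : 0 < σ) (hA : ∀ x : EuclideanSpace ℝ (Fin k),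
      σ * ‖x‖ ≤ ‖(WithLp.toLp 2 (A.mulVec x.ofLp) : EuclideanSpace ℝ (Fin l))‖) :
    IsUnit (A.transpose * A).det := by
  rw [← Matrix.isUnit_iff_isUnit_det, ← Matrix.mulVec_injective_iff_isUnit]
  rw [← Matrix.coe_mulVecLin, ← LinearMap.ker_eq_bot, LinearMap.ker_eq_bot']
  intro x hx
  rw [Matrix.mulVecLin_apply] at hx
  have h1 : dotProduct (A.mulVec x) (A.mulVec x) = 0 := by
    rw [Matrix.dotProduct_mulVec, ← Matrix.mulVec_transpose, Matrix.mulVec_mulVec, hx,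
      zero_dotProduct]
  have h2 := hA (WithLp.toLp 2 x)
  rw [← norm_sq_toLp, sq_eq_zero_iff] at h1
  rw [h1] at h2
  have h3 : ‖(WithLp.toLp 2 x : EuclideanSpace ℝ (Fin k))‖ = 0 := by
    nlinarith [norm_nonneg (WithLp.toLp 2 x : EuclideanSpace ℝ (Fin k))]
  simpa using h3

/-- By the normal equations `z = A^† w` satisfies `‖Az‖² = ⟨w, Az⟩`, hence `‖Az‖ ≤ ‖w‖`; the lower
bound on `A` then controls `‖z‖`. -/
theorem norm_pseudoInverse_mulVec_le {l k : ℕ} {A : Matrix (Fin l) (Fin k) ℝ} {σ : ℝ}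
    (hσ : 0 < σ) (hA : ∀ x : EuclideanSpace ℝ (Fin k),
      σ * ‖x‖ ≤ ‖(WithLp.toLp 2 (A.mulVec x.ofLp) : EuclideanSpace ℝ (Fin l))‖) (w : Fin l → ℝ) :
    σ * ‖(WithLp.toLp 2 (((A.transpose * A)⁻¹ * A.transpose).mulVec w) :
      EuclideanSpace ℝ (Fin k))‖ ≤ ‖(WithLp.toLp 2 w : EuclideanSpace ℝ (Fin l))‖ := by
  have hdet := isUnit_det_transpose_mul_self hσ hA
  set z := ((A.transpose * A)⁻¹ * A.transpose).mulVec w with hz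
  refine (hA (WithLp.toLp 2 z)).trans ?_
  have h1 : (A.transpose * A).mulVec z = A.transpose.mulVec w := by
    rw [hz, Matrix.mulVec_mulVec, ← Matrix.mul_assoc, Matrix.mul_nonsing_inv _ hdet,
      Matrix.one_mul]
  have h2 : dotProduct (A.mulVec z) (A.mulVec z) = dotProduct w (A.mulVec z) := by
    rw [Matrix.dotProduct_mulVec, ← Matrix.mulVec_transpose, Matrix.mulVec_mulVec, h1,
      Matrix.dotProduct_mulVec w, ← Matrix.mulVec_transpose]
  have h3 := dotProduct_le_norm_mul_norm w (A.mulVec z)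
  rw [← h2, ← norm_sq_toLp, sq] at h3
  rcases (norm_nonneg (WithLp.toLp 2 (A.mulVec z) : EuclideanSpace ℝ (Fin l))).eq_or_lt with h | h
  · simp only
    rw [← h]
    exact norm_nonneg _
  · exact le_of_mul_le_mul_right h3 h

theorem betaDual_mul_self {m k l : ℕ} {β σ : ℝ} {E : Matrix (Fin m) (Fin k) ℝ} (hσ : 0 < σ)
    (hA : ∀ x : EuclideanSpace ℝ (Fin k), σ * ‖x‖ ≤
      ‖(WithLp.toLp 2 ((betaCondensation m (m / l) l β * E).mulVec x.ofLp) :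
        EuclideanSpace ℝ (Fin l))‖) :
    betaDual l β E * E = 1 := by
  rw [betaDual, vDual, Matrix.mul_assoc, Matrix.mul_assoc, Matrix.nonsing_inv_mul _
    (isUnit_det_transpose_mul_self hσ hA)]

theorem analysisDistortion_le_schemeDistortion {m k l L : ℕ} {β δ : ℝ} (hL : 1 ≤ L) (hδ : 0 < δ)
    {E : Matrix (Fin m) (Fin k) ℝ} (hE : betaDual l β E * E = 1) :
    analysisDistortion E L ≤
      schemeDistortion E (betaQuantizer m l β L δ) (betaDual l β E) (unitBall k) := by
  have hcard : (arithAlphabet L δ).card = L := by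
    rw [arithAlphabet, Finset.card_image_of_injective, Finset.card_range]
    intro i j hij
    have := mul_right_cancel₀ hδ.ne' hij
    have : (i : ℝ) = j := by linarith
    exact_mod_cast this
  refine (iInf₂_le (arithAlphabet L δ) hcard).trans ((iInf₂_le (betaDual l β E) hE).trans ?_)
  refine iSup₂_mono fun x _ => iInf₂_le _ fun i => ?_
  exact roundArith_mem hL _ _

theorem schemeDistortion_betaQuantizer_le {m k l L : ℕ} {β δ μ σ : ℝ} (hl : 0 < l) (hlm : l ≤ m)
    (hL : 1 ≤ L) (hadm : (β, δ) ∈ admissible μ L) {E : Matrix (Fin m) (Fin k) ℝ} (hσ : 0 < σ)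
    (hμ : ∀ x ∈ unitBall k, ∀ i, |analyze E x i| ≤ μ)
    (hA : ∀ x : EuclideanSpace ℝ (Fin k), σ * ‖x‖ ≤
      ‖(WithLp.toLp 2 ((betaCondensation m (m / l) l β * E).mulVec x.ofLp) :
        EuclideanSpace ℝ (Fin l))‖) :
    schemeDistortion E (betaQuantizer m l β L δ) (betaDual l β E) (unitBall k) ≤
      ENNReal.ofReal (√l * ((β⁻¹) ^ (m / l) * δ) / σ) := by
  refine iSup₂_le fun x hx => ?_
  have hβ : 0 < β := one_pos.trans hadm.1
  have hdual := betaDual_mul_self hσ hA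
  have hx' : x - synthesize (betaDual l β E) (betaQuantizer m l β L δ (analyze E x)) =
      synthesize (betaDual l β E) (analyze E x - betaQuantizer m l β L δ (analyze E x)) := by
    have h1 : x = synthesize (betaDual l β E) (analyze E x) := by
      rw [synthesize, analyze, Matrix.mulVec_mulVec, hdual, Matrix.one_mulVec]
    conv_lhs => rw [h1]
    simp only [synthesize, analyze, Matrix.mulVec_sub, WithLp.toLp_sub, Matrix.mulVec_mulVec, hdual, Matrix.one_mulVec]
  rw [hx', betaQuantizer, sub_greedyQuantizer_betaTransfer, ← ofReal_norm]
  refine ENNReal.ofReal_le_ofReal ?_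
  rw [synthesize, betaDual, vDual, ← Matrix.mulVec_mulVec, le_div_iff₀ hσ, mul_comm]
  exact (norm_pseudoInverse_mulVec_le hσ hA _).trans
    (norm_betaCondensation_betaTransfer_le hβ hl hlm hadm.2.1.le
      (abs_greedyState_le hL hadm (hμ x hx)))

/-! ### Row-normalisation of the condensation matrix -/

theorem norm_mulVec_le_of_mul_transpose_eq_one {l m : ℕ} {W : Matrix (Fin l) (Fin m) ℝ}
    (hW : W * W.transpose = 1) (y : Fin m → ℝ) :
    ‖(WithLp.toLp 2 (W.mulVec y) : EuclideanSpace ℝ (Fin l))‖ ≤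
      ‖(WithLp.toLp 2 y : EuclideanSpace ℝ (Fin m))‖ := by
  have h1 : ‖(WithLp.toLp 2 (W.transpose.mulVec (W.mulVec y)) : EuclideanSpace ℝ (Fin m))‖ =
      ‖(WithLp.toLp 2 (W.mulVec y) : EuclideanSpace ℝ (Fin l))‖ := by
    rw [← sq_eq_sq₀ (norm_nonneg _) (norm_nonneg _), norm_sq_toLp, norm_sq_toLp,
      Matrix.dotProduct_mulVec, ← Matrix.mulVec_transpose, Matrix.transpose_transpose,
      Matrix.mulVec_mulVec, hW, Matrix.one_mulVec]
  have h2 := dotProduct_le_norm_mul_norm (W.transpose.mulVec (W.mulVec y)) y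
  rw [Matrix.mulVec_transpose, ← Matrix.dotProduct_mulVec, ← norm_sq_toLp,
    ← Matrix.mulVec_transpose, h1, sq] at h2
  rcases (norm_nonneg (WithLp.toLp 2 (W.mulVec y) : EuclideanSpace ℝ (Fin l))).eq_or_lt with h | h
  · rw [← h]
    exact norm_nonneg _
  · exact le_of_mul_le_mul_left h2 h

/-- The rows of `V` have disjoint supports, hence are orthogonal, and each has norm at least its
first entry `β⁻¹`. Dividing by the norms gives `W`. -/
theorem exists_rowNormalized_betaCondensation {m l : ℕ} {β : ℝ} (hβ : 0 < β) (hl : 0 < l)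
    (hlm : l ≤ m) : ∃ W : Matrix (Fin l) (Fin m) ℝ, W * W.transpose = 1 ∧
      ∀ y : Fin m → ℝ, β⁻¹ * ‖(WithLp.toLp 2 (W.mulVec y) : EuclideanSpace ℝ (Fin l))‖ ≤
        ‖(WithLp.toLp 2 ((betaCondensation m (m / l) l β).mulVec y) :
          EuclideanSpace ℝ (Fin l))‖ := by
  set V := betaCondensation m (m / l) l β with hV
  have hs0 : 0 < m / l := Nat.div_pos hlm hl
  set d : Fin l → ℝ := fun b => √(∑ i, V b i ^ 2) with hd
  have hdβ : ∀ b, β⁻¹ ≤ d b := by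
    intro b
    have hls : (b.val + 1) * (m / l) ≤ m :=
      (Nat.mul_le_mul_right _ b.2).trans (Nat.mul_div_le m l)
    rw [add_mul, one_mul] at hls
    let i : Fin m := ⟨b.val * (m / l), by omega⟩
    have hi : V b i = β⁻¹ := by
      simp [hV, betaCondensation, i, Nat.mul_div_cancel _ hs0]
    refine Real.le_sqrt_of_sq_le ?_
    rw [← hi]
    exact Finset.single_le_sum (f := fun i => V b i ^ 2) (fun i _ => sq_nonneg _)
      (Finset.mem_univ i)
  have hd0 : ∀ b, 0 < d b := fun b => (inv_pos.2 hβ).trans_le (hdβ b)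
  refine ⟨Matrix.of fun b i => (d b)⁻¹ * V b i, ?_, ?_⟩
  · ext b c
    rw [Matrix.mul_apply]
    simp only [Matrix.of_apply, Matrix.transpose_apply]
    by_cases hbc : b = c
    · subst hbc
      rw [Matrix.one_apply_eq]
      have : ∑ i, V b i ^ 2 = d b ^ 2 := (Real.sq_sqrt (Finset.sum_nonneg fun i _ =>
        sq_nonneg _)).symm
      calc ∑ i, (d b)⁻¹ * V b i * ((d b)⁻¹ * V b i) = (d b)⁻¹ ^ 2 * ∑ i, V b i ^ 2 := by
            rw [Finset.mul_sum]; exact Finset.sum_congr rfl fun i _ => by ring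
        _ = 1 := by
            rw [this, ← mul_pow, inv_mul_cancel₀ (hd0 b).ne', one_pow]
    · rw [Matrix.one_apply_ne hbc]
      refine Finset.sum_eq_zero fun i _ => ?_
      by_cases h : i.val / (m / l) = b.val
      · have : ¬ i.val / (m / l) = c.val := fun h' => hbc (Fin.ext (h.symm.trans h'))
        simp [hV, betaCondensation, this]
      · simp [hV, betaCondensation, h]
  · intro y
    have hy : ∀ b, V.mulVec y b =
        d b * (Matrix.of fun b i => (d b)⁻¹ * V b i).mulVec y b := by
      intro b
      simp only [Matrix.mulVec, dotProduct, Matrix.of_apply]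
      rw [Finset.mul_sum]
      refine Finset.sum_congr rfl fun i _ => ?_
      have := (hd0 b).ne'
      field_simp
    rw [EuclideanSpace.norm_eq, EuclideanSpace.norm_eq]
    refine Real.le_sqrt_of_sq_le ?_
    rw [mul_pow, Real.sq_sqrt (Finset.sum_nonneg fun i _ => sq_nonneg _), Finset.mul_sum]
    refine Finset.sum_le_sum fun b _ => ?_
    simp only
    rw [hy b, norm_mul, mul_pow, Real.norm_of_nonneg (hd0 b).le]
    gcongr
    exact hdβ b

/-! ### Orthogonal images of standard Gaussian vectors -/

/-- Characteristic functions: that of a standard Gaussian at `t` depends only on `‖t‖`, and `Bᵀ`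
preserves norms when `B Bᵀ = 1`. -/
theorem hasLaw_stdGaussian_mulVec {Ω ι κ : Type*} [MeasurableSpace Ω] {P : Measure Ω}
    [IsProbabilityMeasure P] [Fintype ι] [Fintype κ] [DecidableEq κ] {Z : ι → Ω → ℝ}
    (hZ : ∀ i, HasLaw (Z i) (gaussianReal 0 1) P) (hind : iIndepFun Z P)
    {B : Matrix κ ι ℝ} (hB : B * B.transpose = 1) :
    HasLaw (fun ω => (WithLp.toLp 2 (B.mulVec fun i => Z i ω) : EuclideanSpace ℝ κ))
      (stdGaussian (EuclideanSpace ℝ κ)) P := by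
  have h1 : HasLaw (fun ω i => Z i ω) (Measure.pi fun _ : ι => gaussianReal 0 1) P :=
    hind.hasLaw_pi hZ
  have h2 : HasLaw (WithLp.toLp 2) (stdGaussian (EuclideanSpace ℝ ι))
      (Measure.pi fun _ : ι => gaussianReal 0 1) :=
    ⟨by fun_prop, map_pi_eq_stdGaussian⟩
  have hmeas : Measurable fun z : EuclideanSpace ℝ ι =>
      (WithLp.toLp 2 (B.mulVec z.ofLp) : EuclideanSpace ℝ κ) := by
    have : Measurable fun z : EuclideanSpace ℝ ι => B.mulVec z.ofLp := by
      refine measurable_pi_iff.2 fun b => ?_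
      simp only [Matrix.mulVec, dotProduct]
      fun_prop
    fun_prop
  have h3 : HasLaw (fun z : EuclideanSpace ℝ ι =>
      (WithLp.toLp 2 (B.mulVec z.ofLp) : EuclideanSpace ℝ κ))
      (stdGaussian (EuclideanSpace ℝ κ)) (stdGaussian (EuclideanSpace ℝ ι)) := by
    refine ⟨hmeas.aemeasurable, ?_⟩
    have := Measure.isProbabilityMeasure_map (μ := stdGaussian (EuclideanSpace ℝ ι))
      hmeas.aemeasurable
    refine Measure.ext_of_charFun (E := EuclideanSpace ℝ κ) (funext fun t => ?_)
    have hinner : ∀ z : EuclideanSpace ℝ ι,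
        inner ℝ (WithLp.toLp 2 (B.mulVec z.ofLp) : EuclideanSpace ℝ κ) t =
          inner ℝ z (WithLp.toLp 2 (B.transpose.mulVec t.ofLp) : EuclideanSpace ℝ ι) := by
      intro z
      simp only [EuclideanSpace.inner_eq_star_dotProduct, star_trivial]
      rw [Matrix.dotProduct_mulVec, dotProduct_comm, Matrix.mulVec_transpose, dotProduct_comm]
    have hnorm : ‖(WithLp.toLp 2 (B.transpose.mulVec t.ofLp) : EuclideanSpace ℝ ι)‖ ^ 2 =
        ‖t‖ ^ 2 := by
      rw [← real_inner_self_eq_norm_sq, ← hinner, ← real_inner_self_eq_norm_sq]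
      simp only [Matrix.mulVec_mulVec, hB, Matrix.one_mulVec, WithLp.toLp_ofLp]
    rw [charFun_apply, integral_map hmeas.aemeasurable (by fun_prop)]
    simp_rw [hinner]
    rw [← charFun_apply, charFun_stdGaussian, charFun_stdGaussian]
    norm_cast
    rw [hnorm]
  exact (h3.comp h2).comp h1

theorem IsStandardGaussianFrame.hasLaw_mulVec_mulVec {Ω : Type*} [MeasurableSpace Ω]
    {P : Measure Ω} [IsProbabilityMeasure P] {m k l : ℕ} {E : Ω → Matrix (Fin m) (Fin k) ℝ}
    (hE : IsStandardGaussianFrame P E) {W : Matrix (Fin l) (Fin m) ℝ}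
    (hW : W * W.transpose = 1) {x : EuclideanSpace ℝ (Fin k)} (hx : ‖x‖ = 1) :
    HasLaw (fun ω => (WithLp.toLp 2 (W.mulVec ((E ω).mulVec x.ofLp)) :
      EuclideanSpace ℝ (Fin l))) (stdGaussian (EuclideanSpace ℝ (Fin l))) P := by
  -- `WEx` is linear in the entries of `E`, with matrix `W ⊗ xᵀ`; its rows are orthonormal because
  -- those of `W` are and `‖x‖ = 1`.
  set B : Matrix (Fin l) (Fin m × Fin k) ℝ := Matrix.of fun b p => W b p.1 * x p.2 with hBdef
  have hx2 : ∑ j, x j * x j = 1 := by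
    have := EuclideanSpace.real_norm_sq_eq x
    rw [hx] at this
    simpa [sq] using this.symm
  have hB : B * B.transpose = 1 := by
    ext b c
    rw [← hW, Matrix.mul_apply, Matrix.mul_apply, Fintype.sum_prod_type]
    refine Finset.sum_congr rfl fun i _ => ?_
    simp only [hBdef, Matrix.of_apply, Matrix.transpose_apply]
    calc ∑ j, W b i * x j * (W c i * x j) = W b i * W c i * ∑ j, x j * x j := by
          rw [Finset.mul_sum]; exact Finset.sum_congr rfl fun j _ => by ring
      _ = W b i * W c i := by rw [hx2, mul_one]
  refine (hasLaw_stdGaussian_mulVec (Z := fun (p : Fin m × Fin k) ω => E ω p.1 p.2)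
    (fun p => hE.hasLaw p.1 p.2) hE.indep hB).congr (Filter.Eventually.of_forall fun ω => ?_)
  simp only
  congr 1
  ext b
  simp only [Matrix.mulVec, dotProduct, hBdef, Matrix.of_apply, Fintype.sum_prod_type,
    Finset.mul_sum]
  exact Finset.sum_congr rfl fun i _ => Finset.sum_congr rfl fun j _ => by ring

/-! ### Tail and small ball bounds for the standard Gaussian measure -/

theorem lintegral_exp_neg_mul_sq_gaussianReal {a : ℝ} (ha : 0 < 1 + 2 * a) :
    ∫⁻ x, ENNReal.ofReal (Real.exp (-(a * x ^ 2))) ∂gaussianReal 0 1 =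
      ENNReal.ofReal (√(1 / (1 + 2 * a))) := by
  rw [gaussianReal_of_var_ne_zero _ one_ne_zero, lintegral_withDensity_eq_lintegral_mul _
    (measurable_gaussianPDF 0 1) (by fun_prop)]
  have h : ∀ x : ℝ, (gaussianPDF 0 1 * fun x => ENNReal.ofReal (Real.exp (-(a * x ^ 2)))) x =
      ENNReal.ofReal ((√(2 * Real.pi))⁻¹ * Real.exp (-((1 + 2 * a) / 2) * x ^ 2)) := by
    intro x
    rw [Pi.mul_apply, gaussianPDF, ← ENNReal.ofReal_mul (gaussianPDFReal_nonneg _ _ _),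
      gaussianPDFReal, mul_assoc, ← Real.exp_add]
    congr 3
    · simp
    · simp; ring
  simp_rw [h]
  rw [← ofReal_integral_eq_lintegral_ofReal
    ((integrable_exp_neg_mul_sq (by linarith)).const_mul _)
    (Filter.Eventually.of_forall fun x => by positivity), integral_const_mul, integral_gaussian]
  congr 1
  rw [← Real.sqrt_inv, ← Real.sqrt_mul (by positivity)]
  congr 1
  have := Real.pi_ne_zero
  field_simp

/-- Both signs of `a` matter: negative `a` yields the upper tail, positive `a` the small ball
estimate. -/
theorem lintegral_exp_neg_mul_norm_sq_stdGaussian (n : ℕ) {a : ℝ} (ha : 0 < 1 + 2 * a) :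
    ∫⁻ z, ENNReal.ofReal (Real.exp (-(a * ‖z‖ ^ 2))) ∂stdGaussian (EuclideanSpace ℝ (Fin n)) =
      ENNReal.ofReal (√(1 / (1 + 2 * a)) ^ n) := by
  rw [← map_pi_eq_stdGaussian, lintegral_map (by fun_prop) (by fun_prop)]
  have h : ∀ x : Fin n → ℝ, ENNReal.ofReal (Real.exp (-(a * ‖(WithLp.toLp 2 x :
      EuclideanSpace ℝ (Fin n))‖ ^ 2))) =
      ∏ i, ENNReal.ofReal (Real.exp (-(a * x i ^ 2))) := by
    intro x
    rw [← ENNReal.ofReal_prod_of_nonneg (fun i _ => (Real.exp_pos _).le), ← Real.exp_sum,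
      EuclideanSpace.real_norm_sq_eq, Finset.mul_sum, Finset.sum_neg_distrib]
  simp_rw [h]
  rw [lintegral_prod_eq_prod_lintegral_of_indepFun Finset.univ
    (fun i (x : Fin n → ℝ) => ENNReal.ofReal (Real.exp (-(a * x i ^ 2))))
    (iIndepFun_pi (X := fun _ (x : ℝ) => ENNReal.ofReal (Real.exp (-(a * x ^ 2))))
      (fun _ => by fun_prop)) (fun i => by fun_prop)]
  have h2 : ∀ i : Fin n, ∫⁻ x : Fin n → ℝ, ENNReal.ofReal (Real.exp (-(a * x i ^ 2)))
      ∂(Measure.pi fun _ => gaussianReal 0 1) = ENNReal.ofReal (√(1 / (1 + 2 * a))) := by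
    intro i
    rw [← lintegral_exp_neg_mul_sq_gaussianReal ha]
    exact (measurePreserving_eval (fun _ : Fin n => gaussianReal 0 1) i).lintegral_comp
      (f := fun x => ENNReal.ofReal (Real.exp (-(a * x ^ 2)))) (by fun_prop)
  simp_rw [h2]
  rw [Finset.prod_const, Finset.card_univ, Fintype.card_fin, ENNReal.ofReal_pow
    (Real.sqrt_nonneg _)]

theorem stdGaussian_le_norm_le (n : ℕ) :
    stdGaussian (EuclideanSpace ℝ (Fin n)) {z | 4 * √n ≤ ‖z‖} ≤
      ENNReal.ofReal (Real.exp (-(4 * n)) * √2 ^ n) := by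
  -- Chernoff bound with `a = -1/4`: on the event `‖z‖²/4 ≥ 4n`, while the exponential moment is `√2
  -- ^ n`.
  have hM := meas_ge_le_lintegral_div (μ := stdGaussian (EuclideanSpace ℝ (Fin n)))
    (f := fun z => ENNReal.ofReal (Real.exp (-((-1 / 4) * ‖z‖ ^ 2)))) (by fun_prop)
    (ε := ENNReal.ofReal (Real.exp (4 * n))) (by simp [Real.exp_pos]) (by simp)
  rw [lintegral_exp_neg_mul_norm_sq_stdGaussian n (by norm_num),
    ← ENNReal.ofReal_div_of_pos (Real.exp_pos _)] at hM
  refine (measure_mono fun z hz => ?_).trans (hM.trans (ENNReal.ofReal_le_ofReal ?_))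
  · refine ENNReal.ofReal_le_ofReal (Real.exp_le_exp.2 ?_)
    have h1 : (4 * √n) ^ 2 ≤ ‖z‖ ^ 2 := pow_le_pow_left₀ (by positivity) hz 2
    rw [mul_pow, Real.sq_sqrt (Nat.cast_nonneg n)] at h1
    linarith
  · rw [Real.exp_neg, div_eq_inv_mul]
    norm_num

theorem stdGaussian_norm_le_le (n : ℕ) {ε : ℝ} (hε : 0 < ε) :
    stdGaussian (EuclideanSpace ℝ (Fin n)) {z | ‖z‖ ≤ 2 * ε * √n} ≤
      ENNReal.ofReal ((4 * ε) ^ n) := by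
  have ha : 0 < 1 + 2 * (1 / (8 * ε ^ 2)) := by positivity
  -- With `a = 1/(8ε²)` the exponent `a‖z‖²` is at most `n/2` on the event. Each coordinate then
  -- costs a factor `e^(1/2) ≤ 2` times a moment at most `2ε`.
  have hM := meas_ge_le_lintegral_div (μ := stdGaussian (EuclideanSpace ℝ (Fin n)))
    (f := fun z => ENNReal.ofReal (Real.exp (-((1 / (8 * ε ^ 2)) * ‖z‖ ^ 2)))) (by fun_prop)
    (ε := ENNReal.ofReal (Real.exp (-(1 / 2) * n))) (by simp [Real.exp_pos]) (by simp)
  rw [lintegral_exp_neg_mul_norm_sq_stdGaussian n ha,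
    ← ENNReal.ofReal_div_of_pos (Real.exp_pos _)] at hM
  refine (measure_mono fun z hz => ?_).trans (hM.trans (ENNReal.ofReal_le_ofReal ?_))
  · refine ENNReal.ofReal_le_ofReal (Real.exp_le_exp.2 ?_)
    have h1 : ‖z‖ ^ 2 ≤ (2 * ε * √n) ^ 2 := pow_le_pow_left₀ (norm_nonneg z) hz 2
    rw [mul_pow, Real.sq_sqrt (Nat.cast_nonneg n)] at h1
    have h2 : 1 / (8 * ε ^ 2) * ‖z‖ ^ 2 ≤ 1 / (8 * ε ^ 2) * ((2 * ε) ^ 2 * n) :=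
      mul_le_mul_of_nonneg_left h1 (by positivity)
    have h3 : 1 / (8 * ε ^ 2) * ((2 * ε) ^ 2 * n) = 1 / 2 * n := by field_simp; norm_num
    linarith
  · have h1 : √(1 / (1 + 2 * (1 / (8 * ε ^ 2)))) ≤ 2 * ε := by
      refine Real.sqrt_le_iff.2 ⟨by positivity, ?_⟩
      rw [div_le_iff₀ ha]
      have : (2 * ε) ^ 2 * (1 + 2 * (1 / (8 * ε ^ 2))) = 4 * ε ^ 2 + 1 := by field_simp; ring
      nlinarith [sq_nonneg ε]
    have h2 : Real.exp (1 / 2) ≤ 2 := by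
      have h3 : Real.exp (1 / 2) ^ 2 ≤ 2 ^ 2 := by
        rw [← Real.exp_nat_mul]
        have := Real.exp_one_lt_d9
        norm_num
        linarith
      exact le_of_sq_le_sq h3 (by norm_num)
    have h4 : Real.exp (-(1 / 2) * n) = (Real.exp (1 / 2) ^ n)⁻¹ := by
      rw [← Real.exp_nat_mul, ← Real.exp_neg]
      congr 1
      ring
    rw [h4, div_inv_eq_mul, ← mul_pow]
    refine pow_le_pow_left₀ (by positivity) ?_ n
    calc _ ≤ 2 * ε * 2 := mul_le_mul h1 h2 (Real.exp_pos _).le (by positivity)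
      _ = 4 * ε := by ring

/-! ### Nets of the sphere -/

/-- Volume comparison: the balls of radius `θ/2` about the points are disjoint and lie in the ball
of radius `1 + θ/2`. -/
theorem card_mul_pow_le_of_pairwise_dist {k : ℕ} {θ : ℝ} (hθ : 0 < θ)
    {C : Finset (EuclideanSpace ℝ (Fin k))} (hC1 : ∀ x ∈ C, ‖x‖ ≤ 1)
    (hC : ∀ x ∈ C, ∀ y ∈ C, x ≠ y → θ ≤ dist x y) :
    (C.card : ℝ) * (θ / 2) ^ k ≤ (1 + θ / 2) ^ k := by
  set μ : Measure (EuclideanSpace ℝ (Fin k)) := volume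
  have hθ2 : 0 < θ / 2 := by positivity
  have hdisj : (C : Set (EuclideanSpace ℝ (Fin k))).PairwiseDisjoint
      (fun x => Metric.ball x (θ / 2)) := by
    intro x hx y hy hxy
    exact Metric.ball_disjoint_ball (by linarith [hC x hx y hy hxy])
  have hsub : (⋃ x ∈ C, Metric.ball x (θ / 2)) ⊆ Metric.ball 0 (1 + θ / 2) := by
    refine Set.iUnion₂_subset fun x hx => Metric.ball_subset_ball' ?_
    rw [dist_zero_right]
    linarith [hC1 x hx]
  have h1 := measure_mono (μ := μ) hsub
  rw [measure_biUnion_finset hdisj (fun _ _ => measurableSet_ball)] at h1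
  simp_rw [Measure.addHaar_ball_of_pos μ _ hθ2] at h1
  rw [Measure.addHaar_ball_of_pos μ _ (by positivity : 0 < 1 + θ / 2), Finset.sum_const, nsmul_eq_mul, ← mul_assoc,
    ENNReal.mul_le_mul_iff_left (Metric.measure_ball_pos μ 0 one_pos).ne' measure_ball_lt_top.ne,
    finrank_euclideanSpace, Fintype.card_fin] at h1
  rw [← ENNReal.ofReal_natCast, ← ENNReal.ofReal_mul (Nat.cast_nonneg _)] at h1
  exact (ENNReal.ofReal_le_ofReal_iff (by positivity)).1 h1

theorem exists_sphere_net (k : ℕ) {θ : ℝ} (hθ : 0 < θ) (hθ1 : θ ≤ 1) :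
    ∃ N : Finset (EuclideanSpace ℝ (Fin k)), (∀ x ∈ N, ‖x‖ = 1) ∧
      (N.card : ℝ) ≤ (3 / θ) ^ k ∧
      ∀ x : EuclideanSpace ℝ (Fin k), ‖x‖ = 1 → ∃ y ∈ N, ‖x - y‖ ≤ θ := by
  -- A `θ`-separated set of maximal cardinality is a net: a point far from it could be added. `S`
  -- collects the cardinalities, which the volume bound keeps bounded.
  let S : Set ℕ := {n | ∃ N : Finset (EuclideanSpace ℝ (Fin k)), (∀ x ∈ N, ‖x‖ = 1) ∧
    (∀ x ∈ N, ∀ y ∈ N, x ≠ y → θ ≤ dist x y) ∧ N.card = n}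
  have hbound : ∀ N : Finset (EuclideanSpace ℝ (Fin k)), (∀ x ∈ N, ‖x‖ = 1) →
      (∀ x ∈ N, ∀ y ∈ N, x ≠ y → θ ≤ dist x y) → (N.card : ℝ) ≤ (3 / θ) ^ k := by
    intro N h1 h2
    have h := card_mul_pow_le_of_pairwise_dist hθ (fun x hx => (h1 x hx).le) h2
    rw [← le_div_iff₀ (by positivity), ← div_pow] at h
    refine h.trans (pow_le_pow_left₀ (by positivity) ?_ k)
    rw [div_le_div_iff₀ (by positivity) hθ]
    nlinarith
  have hS : S.Nonempty := ⟨0, ∅, by simp, by simp, by simp⟩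
  have hSb : BddAbove S := by
    refine ⟨⌊(3 / θ) ^ k⌋₊, ?_⟩
    rintro n ⟨N, h1, h2, rfl⟩
    exact Nat.le_floor (hbound N h1 h2)
  obtain ⟨N, h1, h2, h3⟩ := Nat.sSup_mem hS hSb
  refine ⟨N, h1, hbound N h1 h2, fun x hx => ?_⟩
  by_contra! hfar
  have hxN : x ∉ N := fun h => by
    have := hfar x h
    rw [sub_self, norm_zero] at this
    linarith
  classical
  have hmem : N.card + 1 ∈ S := by
    refine ⟨insert x N, ?_, ?_, Finset.card_insert_of_notMem hxN⟩
    · intro y hy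
      rcases Finset.mem_insert.1 hy with rfl | hy
      exacts [hx, h1 y hy]
    · intro y hy z hz hyz
      rcases Finset.mem_insert.1 hy with rfl | hy' <;>
        rcases Finset.mem_insert.1 hz with rfl | hz'
      · exact absurd rfl hyz
      · rw [dist_eq_norm]; exact (hfar z hz').le
      · rw [dist_comm, dist_eq_norm]; exact (hfar y hy').le
      · exact h2 y hy' z hz' hyz
  have := le_csSup hSb hmem
  omega

/-! ### Extremal singular values of Gaussian matrices -/

theorem measure_exists_mem_finset_le {Ω α : Type*} [MeasurableSpace Ω] (P : Measure Ω)
    (N : Finset α) (p : α → Ω → Prop) {a b : ℝ} (hN : (N.card : ℝ) ≤ a) (hb : 0 ≤ b)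
    (hp : ∀ y ∈ N, P {ω | p y ω} ≤ ENNReal.ofReal b) :
    P {ω | ∃ y ∈ N, p y ω} ≤ ENNReal.ofReal (a * b) := by
  have h1 : {ω | ∃ y ∈ N, p y ω} = ⋃ y ∈ N, {ω | p y ω} := by ext; simp
  rw [h1]
  calc P (⋃ y ∈ N, {ω | p y ω}) ≤ ∑ y ∈ N, P {ω | p y ω} := measure_biUnion_finset_le _ _
    _ ≤ ∑ _y ∈ N, ENNReal.ofReal b := Finset.sum_le_sum hp
    _ = ENNReal.ofReal (N.card * b) := by
        rw [Finset.sum_const, nsmul_eq_mul, ENNReal.ofReal_mul (Nat.cast_nonneg _),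
          ENNReal.ofReal_natCast]
    _ ≤ ENNReal.ofReal (a * b) :=
        ENNReal.ofReal_le_ofReal (mul_le_mul_of_nonneg_right hN hb)

theorem exists_unit_smul {k : ℕ} {x : EuclideanSpace ℝ (Fin k)} (hx : x ≠ 0) :
    ∃ e : EuclideanSpace ℝ (Fin k), ‖e‖ = 1 ∧ x = ‖x‖ • e :=
  ⟨‖x‖⁻¹ • x, norm_smul_inv_norm hx, by
    rw [smul_smul, mul_inv_cancel₀ (norm_ne_zero_iff.2 hx), one_smul]⟩

theorem norm_map_le_of_net {k m : ℕ} {T : EuclideanSpace ℝ (Fin k) →ₗ[ℝ] EuclideanSpace ℝ (Fin m)}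
    {N : Finset (EuclideanSpace ℝ (Fin k))} {M : ℝ}
    (hN : ∀ x : EuclideanSpace ℝ (Fin k), ‖x‖ = 1 → ∃ y ∈ N, ‖x - y‖ ≤ 1 / 2) (hM : 0 ≤ M)
    (hT : ∀ y ∈ N, ‖T y‖ ≤ M) (x : EuclideanSpace ℝ (Fin k)) : ‖T x‖ ≤ 2 * M * ‖x‖ := by
  set S := LinearMap.toContinuousLinearMap T with hS
  have hST : ∀ x, S x = T x := fun x => rfl
  -- Self-bounding: the error of replacing a unit vector by a net point is at most half of the
  -- operator norm being estimated.
  have h : ‖S‖ ≤ M + ‖S‖ / 2 := by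
    refine S.opNorm_le_bound (by positivity) fun x => ?_
    rcases eq_or_ne x 0 with rfl | hx
    · simp
    obtain ⟨e, he, hxe⟩ := exists_unit_smul hx
    obtain ⟨y, hy, hye⟩ := hN e he
    have h1 : ‖S e‖ ≤ M + ‖S‖ / 2 := by
      have h2 : S e = S y + S (e - y) := by rw [← map_add]; congr 1; abel
      rw [h2]
      have h3 := S.le_opNorm (e - y)
      have h4 := hT y hy
      rw [← hST] at h4
      have h5 : ‖S‖ * ‖e - y‖ ≤ ‖S‖ * (1 / 2) := mul_le_mul_of_nonneg_left hye (norm_nonneg _)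
      linarith [norm_add_le (S y) (S (e - y))]
    rw [hxe, map_smul, norm_smul, norm_smul, he, mul_one, mul_comm]
    exact mul_le_mul_of_nonneg_right h1 (norm_nonneg _)
  have h2 : ‖S‖ ≤ 2 * M := by linarith
  exact (S.le_opNorm x).trans (mul_le_mul_of_nonneg_right h2 (norm_nonneg _))

/-- Moving from a net point to a nearby unit vector loses at most `Mθ ≤ r` out of the `2r` available
on the net. -/
theorem le_norm_map_of_net {k l : ℕ} {T : EuclideanSpace ℝ (Fin k) →ₗ[ℝ] EuclideanSpace ℝ (Fin l)}
    {N : Finset (EuclideanSpace ℝ (Fin k))} {M r θ : ℝ}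
    (hN : ∀ x : EuclideanSpace ℝ (Fin k), ‖x‖ = 1 → ∃ y ∈ N, ‖x - y‖ ≤ θ) (hM : 0 ≤ M)
    (hTM : ∀ x, ‖T x‖ ≤ M * ‖x‖) (hθ : M * θ ≤ r)
    (hT : ∀ y ∈ N, 2 * r < ‖T y‖) (x : EuclideanSpace ℝ (Fin k)) : r * ‖x‖ ≤ ‖T x‖ := by
  rcases eq_or_ne x 0 with rfl | hx
  · simp
  obtain ⟨e, he, hxe⟩ := exists_unit_smul hx
  obtain ⟨y, hy, hye⟩ := hN e he
  have h1 : r ≤ ‖T e‖ := by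
    have h2 : T y = T e - T (e - y) := by rw [← map_sub]; congr 1; abel
    have h3 := hT y hy
    have h4 := norm_sub_le (T e) (T (e - y))
    rw [← h2] at h4
    have h5 := (hTM (e - y)).trans (mul_le_mul_of_nonneg_left hye hM)
    linarith
  rw [hxe, map_smul, norm_smul, norm_smul, he, norm_norm, mul_one, mul_comm]
  exact mul_le_mul_of_nonneg_left h1 (norm_nonneg _)

variable {Ω : Type*} [MeasurableSpace Ω] {P : Measure Ω} [IsProbabilityMeasure P] {m k l : ℕ}
  {E : Ω → Matrix (Fin m) (Fin k) ℝ}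

theorem IsStandardGaussianFrame.measure_not_norm_mulVec_le (hE : IsStandardGaussianFrame P E) :
    P {ω | ¬ ∀ x : EuclideanSpace ℝ (Fin k), ‖(WithLp.toLp 2 ((E ω).mulVec x.ofLp) :
      EuclideanSpace ℝ (Fin m))‖ ≤ 8 * √m * ‖x‖} ≤
      ENNReal.ofReal (6 ^ k * (Real.exp (-(4 * m)) * √2 ^ m)) := by
  obtain ⟨N, hN1, hNcard, hN⟩ := exists_sphere_net k (θ := 1 / 2) (by norm_num) (by norm_num)
  rw [show (3 : ℝ) / (1 / 2) = 6 by norm_num] at hNcard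
  refine (measure_mono fun ω hω => ?_).trans (measure_exists_mem_finset_le P N
    (fun y ω => 4 * √m ≤ ‖(WithLp.toLp 2 ((E ω).mulVec y.ofLp) : EuclideanSpace ℝ (Fin m))‖)
    hNcard (by positivity) fun y hy => ?_)
  · simp only [Set.mem_ofPred_eq] at hω ⊢
    contrapose! hω
    intro x
    have : ‖(WithLp.toLp 2 ((E ω).mulVec x.ofLp) : EuclideanSpace ℝ (Fin m))‖ ≤
        2 * (4 * √m) * ‖x‖ :=
      norm_map_le_of_net (T := Matrix.toEuclideanLin (E ω)) hN (by positivity)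
        (fun y hy => (hω y hy).le) x
    linarith
  · have hlaw := hE.hasLaw_mulVec_mulVec (W := (1 : Matrix (Fin m) (Fin m) ℝ)) (by simp) (hN1 y hy)
    simp only [Matrix.one_mulVec] at hlaw
    rw [hlaw.measure_eq (p := fun z => 4 * √m ≤ ‖z‖)
      (measurableSet_le measurable_const measurable_norm)]
    exact stdGaussian_le_norm_le m

/-- The upper bound `M` on `E` is part of the event because it fixes the net scale `θ = ε√l / M`.
The union bound multiplies the net size `(3/θ)^k` by the small ball probability `(4ε)^l`. -/
theorem IsStandardGaussianFrame.measure_not_le_norm_mulVec_le (hE : IsStandardGaussianFrame P E)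
    {W : Matrix (Fin l) (Fin m) ℝ} (hW : W * W.transpose = 1) {M ε : ℝ} (hε : 0 < ε) (hl : 0 < l)
    (hM : ε * √l ≤ M) :
    P {ω | (∀ x : EuclideanSpace ℝ (Fin k), ‖(WithLp.toLp 2 ((E ω).mulVec x.ofLp) :
      EuclideanSpace ℝ (Fin m))‖ ≤ M * ‖x‖) ∧
      ¬ ∀ x : EuclideanSpace ℝ (Fin k), ε * √l * ‖x‖ ≤
        ‖(WithLp.toLp 2 (W.mulVec ((E ω).mulVec x.ofLp)) : EuclideanSpace ℝ (Fin l))‖} ≤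
      ENNReal.ofReal ((3 * M / (ε * √l)) ^ k * (4 * ε) ^ l) := by
  have hr : 0 < ε * √l := by positivity
  have hM0 : 0 < M := hr.trans_le hM
  obtain ⟨N, hN1, hNcard, hN⟩ := exists_sphere_net k (θ := ε * √l / M) (by positivity)
    ((div_le_one hM0).2 hM)
  rw [div_div_eq_mul_div] at hNcard
  refine (measure_mono fun ω hω => ?_).trans (measure_exists_mem_finset_le P N
    (fun y ω => ‖(WithLp.toLp 2 (W.mulVec ((E ω).mulVec y.ofLp)) : EuclideanSpace ℝ (Fin l))‖ ≤
      2 * ε * √l)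
    hNcard (by positivity) fun y hy => ?_)
  · obtain ⟨h1, h2⟩ := hω
    simp only [Set.mem_ofPred_eq]
    contrapose! h2
    intro x
    have := le_norm_map_of_net (T := Matrix.toEuclideanLin (W * E ω)) hN hM0.le (r := ε * √l)
      (fun x => ?_) (by field_simp; rfl) (fun y hy => ?_) x
    · rw [Matrix.mulVec_mulVec]
      exact this
    · have h3 := (norm_mulVec_le_of_mul_transpose_eq_one hW ((E ω).mulVec x.ofLp)).trans (h1 x)
      rw [Matrix.mulVec_mulVec] at h3
      exact h3
    · have h3 := h2 y hy
      rw [Matrix.mulVec_mulVec, mul_assoc] at h3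
      exact h3
  · rw [(hE.hasLaw_mulVec_mulVec hW (hN1 y hy)).measure_eq (p := fun z => ‖z‖ ≤ 2 * ε * √l)
      (measurableSet_le measurable_norm measurable_const)]
    exact stdGaussian_norm_le_le l hε

/-! ### Choice of the parameters -/

theorem pow_le_two_rpow_of_log_le {ρ c : ℝ} (hρ : 0 < ρ) (hc : 0 ≤ c) (h : Real.log ρ ≤ c)
    (n : ℕ) : ρ ^ n ≤ (2 : ℝ) ^ (n * (2 * c)) := by
  have h2 : (1 : ℝ) / 2 ≤ Real.log 2 := by linarith [Real.log_two_gt_d9]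
  have h1 : ρ ≤ (2 : ℝ) ^ (2 * c) := by
    rw [Real.rpow_def_of_pos two_pos, ← Real.log_le_iff_le_exp hρ]
    nlinarith
  calc ρ ^ n ≤ ((2 : ℝ) ^ (2 * c)) ^ n := pow_le_pow_left₀ hρ.le h1 n
    _ = (2 : ℝ) ^ (n * (2 * c)) := by
        rw [← Real.rpow_natCast, ← Real.rpow_mul two_pos.le, mul_comm]

/-- The number of blocks. -/
noncomputable def numBlocks (η : ℝ) (k : ℕ) : ℕ := ⌈(1 + η / 4) * k⌉₊

theorem le_numBlocks (η : ℝ) (k : ℕ) : (1 + η / 4) * k ≤ numBlocks η k := Nat.le_ceil _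

/-- Rounding up costs at most `1 ≤ ηk/8`. -/
theorem numBlocks_le {η : ℝ} {k : ℕ} (hη : 0 < η) (hk : 8 / η ≤ k) :
    (numBlocks η k : ℝ) ≤ (1 + 3 * η / 8) * k := by
  have h1 : (numBlocks η k : ℝ) < (1 + η / 4) * k + 1 := Nat.ceil_lt_add_one (by positivity)
  rw [div_le_iff₀ hη] at hk
  linarith

section Parameters

variable {η : ℝ} {k m : ℕ} (hη : 0 < η) (hη' : η ≤ 1 / 2) (hk : 8 / η ≤ (k : ℝ))
  (hkm : 2 * k ≤ m) (hc : 1000 / η ^ 2 * Real.log ((m : ℝ) / k) ≤ (m : ℝ) / k)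

include hη hη' hk in
theorem sixteen_le_of_eight_div_le : (16 : ℝ) ≤ k := by
  refine le_trans ?_ hk
  rw [le_div_iff₀ hη]
  linarith

include hη hη' hk hkm in
theorem two_le_ratio : (2 : ℝ) ≤ (m : ℝ) / k := by
  have := sixteen_le_of_eight_div_le hη hη' hk
  rw [le_div_iff₀ (by linarith)]
  exact_mod_cast hkm

include hη hc in
theorem log_ratio_le : Real.log ((m : ℝ) / k) ≤ η ^ 2 * (m / k) / 1000 := by
  rw [div_mul_eq_mul_div, div_le_iff₀ (by positivity)] at hc
  linarith

include hη hη' hk hkm hc in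
theorem le_eta_sq_mul_ratio : 500 ≤ η ^ 2 * ((m : ℝ) / k) := by
  have h1 := log_ratio_le hη hc
  have h2 := Real.log_le_log two_pos (two_le_ratio hη hη' hk hkm)
  linarith [Real.log_two_gt_d9]

include hη hη' hk hkm hc in
-- Since `(1 - 3η/8)(1 + 3η/8) ≤ 1`, `m/l ≥ (1 - 3η/8)ρ`; the floor costs a further `1 ≤ ηρ/8`,
-- leaving `(1 - η/2)ρ`.
theorem ratio_le_blockLength :
    (1 - η) * ((m : ℝ) / k) + η * (m / k) / 2 ≤ (m / numBlocks η k : ℕ) := by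
  have hk16 := sixteen_le_of_eight_div_le hη hη' hk
  have hρ2 := two_le_ratio hη hη' hk hkm
  have hηρ := le_eta_sq_mul_ratio hη hη' hk hkm hc
  set ρ := (m : ℝ) / k with hρ
  have hm : (m : ℝ) = ρ * k := by rw [hρ]; field_simp
  have hl := numBlocks_le hη hk
  have hl0 : (0 : ℝ) < numBlocks η k := lt_of_lt_of_le (by positivity) (le_numBlocks η k)
  have hfloor : (m : ℝ) / numBlocks η k < (m / numBlocks η k : ℕ) + 1 := by
    rw [← Nat.floor_div_eq_div (K := ℝ)]
    exact Nat.lt_floor_add_one _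
  have h1 : ρ * (1 - 3 * η / 8) ≤ (m : ℝ) / numBlocks η k := by
    rw [le_div_iff₀ hl0, hm]
    calc ρ * (1 - 3 * η / 8) * numBlocks η k ≤ ρ * (1 - 3 * η / 8) * ((1 + 3 * η / 8) * k) :=
          mul_le_mul_of_nonneg_left hl (mul_nonneg (by linarith) (by linarith))
      _ = ρ * k * (1 - (3 * η / 8) ^ 2) := by ring
      _ ≤ ρ * k * 1 := mul_le_mul_of_nonneg_left (by nlinarith) (by positivity)
      _ = ρ * k := mul_one _
  have h2 : 8 ≤ η * ρ := by nlinarith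
  linarith

include hη hη' hk hkm in
theorem numBlocks_bounds : k ≤ numBlocks η k ∧ numBlocks η k ≤ 2 * k ∧ numBlocks η k ≤ m := by
  have hk16 := sixteen_le_of_eight_div_le hη hη' hk
  have h1 := le_numBlocks η k
  have h2 := numBlocks_le hη hk
  have h3 : (numBlocks η k : ℝ) ≤ 2 * k := by nlinarith
  have h4 : (k : ℝ) ≤ numBlocks η k := by nlinarith
  have h5 : numBlocks η k ≤ 2 * k := by exact_mod_cast h3
  exact ⟨by exact_mod_cast h4, h5, h5.trans hkm⟩

include hη hη' hk hkm hc in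
theorem reconstruction_error_le {L : ℕ} (hL : 2 ≤ L) :
    24 * √m * (m / numBlocks η k : ℕ) * ((L : ℝ)⁻¹) ^ (m / numBlocks η k) ≤
      √k * (L : ℝ) ^ (-((1 - η) * ((m : ℝ) / k))) * (L : ℝ) ^ (-(η * ((m : ℝ) / k) / 4)) := by
  have hk16 := sixteen_le_of_eight_div_le hη hη' hk
  have hρ2 := two_le_ratio hη hη' hk hkm
  have hlog := log_ratio_le hη hc
  have hs := ratio_le_blockLength hη hη' hk hkm hc
  obtain ⟨hkl, -, -⟩ := numBlocks_bounds hη hη' hk hkm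
  have hk0 : 0 < k := by
    have : (0 : ℝ) < k := by linarith
    exact_mod_cast this
  have hsρ : ((m / numBlocks η k : ℕ) : ℝ) ≤ (m : ℝ) / k :=
    Nat.cast_div_le.trans (by gcongr)
  set s := m / numBlocks η k
  set ρ := (m : ℝ) / k with hρ
  have hm : √(m : ℝ) = √k * √ρ := by
    rw [← Real.sqrt_mul (by positivity)]; congr 1; rw [hρ]; field_simp
  have hL0 : (0 : ℝ) < L := by positivity
  have hL2 : (2 : ℝ) ≤ L := by exact_mod_cast hL
  -- As `ρ ≥ 2`, constants are absorbed into powers of `ρ`, and `log ρ ≤ η²ρ/1000` makes a fixed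
  -- power of `ρ` negligible.
  have h1 : 24 * √ρ * s ≤ (2 : ℝ) ^ (η * ρ / 4) := by
    have ha : √ρ ≤ ρ := Real.sqrt_le_iff.2 ⟨by linarith, by nlinarith⟩
    calc 24 * √ρ * s ≤ 32 * ρ * ρ := by gcongr; norm_num
      _ ≤ ρ ^ 5 * ρ * ρ := by
          gcongr
          calc (32 : ℝ) = 2 ^ 5 := by norm_num
            _ ≤ ρ ^ 5 := by gcongr
      _ = ρ ^ 7 := by ring
      _ ≤ (2 : ℝ) ^ (((7 : ℕ) : ℝ) * (2 * (η ^ 2 * ρ / 1000))) :=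
          pow_le_two_rpow_of_log_le (by linarith) (by positivity) hlog 7
      _ ≤ (2 : ℝ) ^ (η * ρ / 4) := by
          refine Real.rpow_le_rpow_of_exponent_le one_le_two ?_
          have : η * (η * ρ) ≤ 1 / 2 * (η * ρ) := by gcongr
          push_cast
          nlinarith [mul_pos hη (by linarith : 0 < ρ)]
  have h2 : 24 * √ρ * s ≤ (L : ℝ) ^ (s - (1 - η) * ρ - η * ρ / 4) := by
    refine h1.trans ((Real.rpow_le_rpow two_pos.le hL2 (by positivity)).trans ?_)
    exact Real.rpow_le_rpow_of_exponent_le (by linarith) (by linarith)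
  calc 24 * √m * s * ((L : ℝ)⁻¹) ^ s = √k * (24 * √ρ * s) * (L : ℝ) ^ (-(s : ℝ)) := by
        rw [hm, Real.rpow_neg hL0.le, Real.rpow_natCast, inv_pow]; ring
    _ ≤ √k * (L : ℝ) ^ (s - (1 - η) * ρ - η * ρ / 4) * (L : ℝ) ^ (-(s : ℝ)) := by gcongr
    _ = _ := by
        rw [mul_assoc, mul_assoc, ← Real.rpow_add hL0, ← Real.rpow_add hL0]
        congr 2
        ring

include hη hη' hk hkm hc in
-- The net contributes `ε^(-k)` and the small ball `ε^l`. Since `l - k ≥ ηk/4`, the product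
-- `ε^(l-k)` is at most `L^(-η²m/16)`, and half of this exponent pays for the factor `(384√ρ)^k`.
theorem small_singular_value_probability_le {L : ℕ} (hL : 2 ≤ L) :
    (3 * (8 * √m) / ((L : ℝ) ^ (-(η * ((m : ℝ) / k) / 4)) * √(numBlocks η k))) ^ k *
      (4 * (L : ℝ) ^ (-(η * ((m : ℝ) / k) / 4))) ^ numBlocks η k ≤
        (L : ℝ) ^ (-(η ^ 2 * m / 32)) := by
  have hk16 := sixteen_le_of_eight_div_le hη hη' hk
  have hρ2 := two_le_ratio hη hη' hk hkm
  have hlog := log_ratio_le hη hc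
  obtain ⟨hkl, hl2, -⟩ := numBlocks_bounds hη hη' hk hkm
  have hlk := le_numBlocks η k
  have hk0 : (0 : ℝ) < k := by linarith
  set l := numBlocks η k
  set ρ := (m : ℝ) / k with hρ
  have hmk : (m : ℝ) = ρ * k := by rw [hρ]; field_simp
  have hm : √(m : ℝ) = √k * √ρ := by
    rw [← Real.sqrt_mul (by positivity)]; congr 1; rw [hρ]; field_simp
  have hL0 : (0 : ℝ) < L := by positivity
  have hL2 : (2 : ℝ) ≤ L := by exact_mod_cast hL
  set ε := (L : ℝ) ^ (-(η * ρ / 4)) with hε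
  have hε0 : 0 < ε := by positivity
  have hsk : 0 < √(k : ℝ) := Real.sqrt_pos.2 hk0
  have hsl : √(k : ℝ) ≤ √l := Real.sqrt_le_sqrt (by exact_mod_cast hkl)
  obtain ⟨d, hd⟩ := Nat.exists_eq_add_of_le hkl
  have h1 : 3 * (8 * √m) / (ε * √l) ≤ 24 * √ρ / ε := by
    rw [div_le_div_iff₀ (mul_pos hε0 (hsk.trans_le hsl)) hε0, hm]
    calc 3 * (8 * (√k * √ρ)) * ε = 24 * √ρ * ε * √k := by ring
      _ ≤ 24 * √ρ * ε * √l := by gcongr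
      _ = _ := by ring
  have h2 : 384 * √ρ ≤ (2 : ℝ) ^ (η ^ 2 * ρ / 32) := by
    have ha : √ρ ≤ ρ := Real.sqrt_le_iff.2 ⟨by linarith, by nlinarith⟩
    calc 384 * √ρ ≤ 512 * ρ := by gcongr; norm_num
      _ ≤ ρ ^ 9 * ρ := by
          gcongr
          calc (512 : ℝ) = 2 ^ 9 := by norm_num
            _ ≤ ρ ^ 9 := by gcongr
      _ = ρ ^ 10 := by ring
      _ ≤ (2 : ℝ) ^ (((10 : ℕ) : ℝ) * (2 * (η ^ 2 * ρ / 1000))) :=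
          pow_le_two_rpow_of_log_le (by linarith) (by positivity) hlog 10
      _ ≤ (2 : ℝ) ^ (η ^ 2 * ρ / 32) := by
          refine Real.rpow_le_rpow_of_exponent_le one_le_two ?_
          push_cast
          nlinarith [mul_pos (pow_pos hη 2) (by linarith : 0 < ρ)]
  have h3 : ε ^ d ≤ (L : ℝ) ^ (-(η ^ 2 * m / 16)) := by
    rw [hε, ← Real.rpow_natCast, ← Real.rpow_mul hL0.le]
    refine Real.rpow_le_rpow_of_exponent_le (by linarith) ?_
    have hd' : η / 4 * k ≤ d := by
      have : (l : ℝ) = k + d := by exact_mod_cast hd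
      linarith
    have : η * ρ / 4 * (η / 4 * k) ≤ η * ρ / 4 * d :=
      mul_le_mul_of_nonneg_left hd' (by positivity)
    rw [hmk]
    linarith
  calc (3 * (8 * √m) / (ε * √l)) ^ k * (4 * ε) ^ l
      ≤ (24 * √ρ / ε) ^ k * (4 ^ (2 * k) * ε ^ l) := by
        rw [mul_pow 4 ε]
        gcongr
        norm_num
    _ = (384 * √ρ) ^ k * ε ^ d := by
        rw [hd, pow_add, pow_mul, div_pow, ← mul_assoc, div_mul_eq_mul_div, ← mul_pow]
        field_simp
        congr 1
        ring
    _ ≤ ((2 : ℝ) ^ (η ^ 2 * ρ / 32)) ^ k * (L : ℝ) ^ (-(η ^ 2 * m / 16)) := by gcongr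
    _ ≤ (L : ℝ) ^ (η ^ 2 * m / 32) * (L : ℝ) ^ (-(η ^ 2 * m / 16)) := by
        gcongr
        rw [← Real.rpow_natCast, ← Real.rpow_mul two_pos.le]
        rw [show η ^ 2 * ρ / 32 * k = η ^ 2 * m / 32 by rw [hmk]; ring]
        exact Real.rpow_le_rpow two_pos.le hL2 (by positivity)
    _ = (L : ℝ) ^ (-(η ^ 2 * m / 32)) := by
        rw [← Real.rpow_add hL0]; congr 1; ring

include hη hη' hk hkm hc in
theorem failure_probability_le :
    6 ^ k * (Real.exp (-(4 * m)) * √2 ^ m) + 8 * (2 : ℝ) ^ (-(η ^ 2 * m / 32)) ≤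
      Real.exp (-(1 / 128 * η ^ 2 * m)) := by
  have hk16 := sixteen_le_of_eight_div_le hη hη' hk
  have hηρ := le_eta_sq_mul_ratio hη hη' hk hkm hc
  have hk0 : (0 : ℝ) < k := by linarith
  have hbig : 8000 ≤ η ^ 2 * m := by
    have : η ^ 2 * m = η ^ 2 * ((m : ℝ) / k) * k := by field_simp
    rw [this]
    nlinarith
  have hm0 : (0 : ℝ) ≤ m := Nat.cast_nonneg m
  have h1 : 6 ^ k * (Real.exp (-(4 * m)) * √2 ^ m) ≤ Real.exp (-(η ^ 2 * m / 64)) := by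
    have hs2 : √2 ≤ 3 / 2 := Real.sqrt_le_iff.2 ⟨by norm_num, by norm_num⟩
    have he : (9 : ℝ) ≤ Real.exp 4 := by
      rw [show (4 : ℝ) = (4 : ℕ) * 1 by norm_num, Real.exp_nat_mul]
      have h2 : (2 : ℝ) ≤ Real.exp 1 := by linarith [Real.add_one_le_exp 1]
      calc (9 : ℝ) ≤ 2 ^ 4 := by norm_num
        _ ≤ Real.exp 1 ^ 4 := by gcongr
    have he3 : (9 : ℝ) ≤ Real.exp 3 := by
      rw [show (3 : ℝ) = (3 : ℕ) * 1 by norm_num, Real.exp_nat_mul]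
      have h2 : (2.7 : ℝ) ≤ Real.exp 1 := by linarith [Real.exp_one_gt_d9]
      calc (9 : ℝ) ≤ 2.7 ^ 3 := by norm_num
        _ ≤ Real.exp 1 ^ 3 := by gcongr
    calc 6 ^ k * (Real.exp (-(4 * m)) * √2 ^ m)
        ≤ 6 ^ m * (Real.exp (-(4 * m)) * (3 / 2) ^ m) := by
          gcongr
          · norm_num
          · omega
      _ = 9 ^ m * Real.exp (-(4 * m)) := by
          rw [mul_left_comm, ← mul_pow, mul_comm]; norm_num
      _ ≤ Real.exp 3 ^ m * Real.exp (-(4 * m)) := by gcongr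
      _ = Real.exp (-m) := by
          rw [← Real.exp_nat_mul, ← Real.exp_add]; congr 1; ring
      _ ≤ Real.exp (-(η ^ 2 * m / 64)) := by
          refine Real.exp_le_exp.2 ?_
          have : η ^ 2 ≤ 1 := by nlinarith
          nlinarith
  have h2 : (2 : ℝ) ^ (-(η ^ 2 * m / 32)) ≤ Real.exp (-(η ^ 2 * m / 64)) := by
    rw [Real.rpow_def_of_pos two_pos]
    refine Real.exp_le_exp.2 ?_
    nlinarith [Real.log_two_gt_d9]
  -- The `9 = 1 + 8` counts both terms after each exponential is bounded by `exp(-η²m/64)`; halving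
  -- the exponent absorbs it.
  have h3 : 9 * Real.exp (-(η ^ 2 * m / 64)) ≤ Real.exp (-(1 / 128 * η ^ 2 * m)) := by
    have h4 : (9 : ℝ) ≤ Real.exp (η ^ 2 * m / 128) := by
      linarith [Real.add_one_le_exp (η ^ 2 * m / 128)]
    calc 9 * Real.exp (-(η ^ 2 * m / 64)) ≤
          Real.exp (η ^ 2 * m / 128) * Real.exp (-(η ^ 2 * m / 64)) := by gcongr
      _ = _ := by rw [← Real.exp_add]; congr 1; ring
  linarith

end Parameters

/-! ### Union bound over the alphabet size and final assembly. -/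

/-- For `L ≥ 2`, `L^(-p) ≤ 2^(2-p) L⁻²`, and the sum of `L⁻²` is `π²/6 ≤ 2`. -/
theorem tsum_ofReal_rpow_neg_le {p : ℝ} (hp : 2 ≤ p) {f : ℕ → ℝ≥0∞}
    (hf0 : ∀ L < 2, f L = 0) (hf : ∀ L : ℕ, 2 ≤ L → f L ≤ ENNReal.ofReal ((L : ℝ) ^ (-p))) :
    ∑' L, f L ≤ ENNReal.ofReal (8 * (2 : ℝ) ^ (-p)) := by
  have hz := hasSum_zeta_two
  have hterm : ∀ L, f L ≤ ENNReal.ofReal (4 * (2 : ℝ) ^ (-p) * (1 / (L : ℝ) ^ 2)) := by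
    intro L
    rcases lt_or_ge L 2 with h | h
    · rw [hf0 L h]; exact zero_le
    · refine (hf L h).trans (ENNReal.ofReal_le_ofReal ?_)
      have hL0 : (0 : ℝ) < L := by positivity
      have hL2 : (2 : ℝ) ≤ L := by exact_mod_cast h
      have e1 : (L : ℝ) ^ (-p) = (L : ℝ) ^ (-(p - 2)) * (1 / (L : ℝ) ^ 2) := by
        rw [one_div, ← Real.rpow_natCast, ← Real.rpow_neg hL0.le, ← Real.rpow_add hL0]
        congr 1; push_cast; ring
      have e2 : 4 * (2 : ℝ) ^ (-p) = (2 : ℝ) ^ (-(p - 2)) := by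
        rw [show (4 : ℝ) = 2 ^ (2 : ℝ) by norm_num, ← Real.rpow_add two_pos]
        congr 1; ring
      rw [e1, e2]
      gcongr ?_ * _
      exact Real.rpow_le_rpow_of_nonpos two_pos hL2 (by linarith)
  refine (ENNReal.tsum_le_tsum hterm).trans ?_
  rw [← ENNReal.ofReal_tsum_of_nonneg (fun L => by positivity) (hz.summable.mul_left _),
    tsum_mul_left, hz.tsum_eq]
  refine ENNReal.ofReal_le_ofReal ?_
  have hpi : Real.pi ^ 2 / 6 ≤ 2 := by nlinarith [Real.pi_lt_d2, Real.pi_pos]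
  have : (0 : ℝ) ≤ (2 : ℝ) ^ (-p) := by positivity
  nlinarith

/-- Passing to a measurable hull of the bad set avoids proving measurability of events quantified
over all `x`. -/
theorem one_sub_le_measureReal_compl_toMeasurable {Ω : Type*} [MeasurableSpace Ω]
    {P : Measure Ω} [IsProbabilityMeasure P] {B : Set Ω} {b : ℝ} (hb : 0 ≤ b)
    (hB : P B ≤ ENNReal.ofReal b) : 1 - b ≤ P.real (toMeasurable P B)ᶜ := by
  rw [probReal_compl_eq_one_sub (measurableSet_toMeasurable P B), measureReal_def,
    measure_toMeasurable]
  linarith [ENNReal.toReal_le_of_le_ofReal hb hB]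

/-- The constraint `β + μ/δ ≤ L` is saturated; along its boundary `β = Ls/(s+1)` maximises `β^s (L -
β)`, that is, minimises `β⁻ˢ δ`. -/
theorem mem_admissible {L s : ℕ} {μ : ℝ} (hs : 2 ≤ s) (hL : 2 ≤ L) (hμ : 0 < μ) :
    ((L * s / (s + 1) : ℝ), (μ * (s + 1) / L : ℝ)) ∈ admissible μ L := by
  have hs' : (2 : ℝ) ≤ s := by exact_mod_cast hs
  have hL' : (2 : ℝ) ≤ L := by exact_mod_cast hL
  refine ⟨?_, by positivity, le_of_eq ?_⟩
  · simp only
    rw [lt_div_iff₀ (by positivity)]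
    nlinarith
  · simp only
    field_simp

theorem schemeDistortion_le_of_singular_values {m k l L : ℕ} {ε μ : ℝ} (hl : 0 < l)
    (hlm : l ≤ m) (hs : 2 ≤ m / l) (hL : 2 ≤ L) (hε : 0 < ε) (hμ0 : 0 < μ)
    {E : Matrix (Fin m) (Fin k) ℝ} (hμ : ∀ x ∈ unitBall k, ∀ i, |analyze E x i| ≤ μ)
    {β : ℝ} (hβ : β = L * (m / l : ℕ) / ((m / l : ℕ) + 1))
    {W : Matrix (Fin l) (Fin m) ℝ} (hW : ∀ y : Fin m → ℝ,
      β⁻¹ * ‖(WithLp.toLp 2 (W.mulVec y) : EuclideanSpace ℝ (Fin l))‖ ≤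
        ‖(WithLp.toLp 2 ((betaCondensation m (m / l) l β).mulVec y) :
          EuclideanSpace ℝ (Fin l))‖)
    (hWE : ∀ x : EuclideanSpace ℝ (Fin k), ε * √l * ‖x‖ ≤
      ‖(WithLp.toLp 2 (W.mulVec (E.mulVec x.ofLp)) : EuclideanSpace ℝ (Fin l))‖) :
    betaDual l β E * E = 1 ∧
      schemeDistortion E (betaQuantizer m l β L (μ * ((m / l : ℕ) + 1) / L)) (betaDual l β E)
        (unitBall k) ≤
      ENNReal.ofReal (3 * μ * (m / l : ℕ) * ((L : ℝ)⁻¹) ^ (m / l) / ε) := by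
  set s := m / l with hsdef
  have hs' : (2 : ℝ) ≤ s := by exact_mod_cast hs
  have hL0 : (0 : ℝ) < L := by positivity
  have hβ0 : 0 < β := by rw [hβ]; positivity
  have hl0 : 0 < √(l : ℝ) := Real.sqrt_pos.2 (by exact_mod_cast hl)
  have hσ : 0 < β⁻¹ * (ε * √l) := by positivity
  have hA : ∀ x : EuclideanSpace ℝ (Fin k), β⁻¹ * (ε * √l) * ‖x‖ ≤
      ‖(WithLp.toLp 2 ((betaCondensation m s l β * E).mulVec x.ofLp) :
        EuclideanSpace ℝ (Fin l))‖ := by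
    intro x
    rw [← Matrix.mulVec_mulVec, mul_assoc]
    exact (mul_le_mul_of_nonneg_left (hWE x) (inv_nonneg.2 hβ0.le)).trans (hW _)
  refine ⟨betaDual_mul_self hσ hA, ?_⟩
  have hadm := mem_admissible (L := L) hs hL hμ0
  rw [← hβ] at hadm
  refine (schemeDistortion_betaQuantizer_le hl hlm (by omega) hadm hσ hμ hA).trans
    (ENNReal.ofReal_le_ofReal ?_)
  -- Having `β` slightly below `L` costs only this factor in `β⁻ˢ`.
  have hexp : (1 + (s : ℝ)⁻¹) ^ s ≤ 3 := by
    calc (1 + (s : ℝ)⁻¹) ^ s ≤ Real.exp ((s : ℝ)⁻¹) ^ s := by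
          gcongr
          linarith [Real.add_one_le_exp (s : ℝ)⁻¹]
      _ = Real.exp 1 := by
          rw [← Real.exp_nat_mul, mul_inv_cancel₀ (by positivity)]
      _ ≤ 3 := by linarith [Real.exp_one_lt_d9]
  have hinv : β⁻¹ = (L : ℝ)⁻¹ * (1 + (s : ℝ)⁻¹) := by rw [hβ]; field_simp
  rw [← hsdef]
  calc √l * ((β⁻¹) ^ s * (μ * (s + 1) / L)) / (β⁻¹ * (ε * √l))
      = (β⁻¹) ^ s * (μ * (β * (s + 1) / L)) / ε := by field_simp
    _ = (1 + (s : ℝ)⁻¹) ^ s * (μ * s * ((L : ℝ)⁻¹) ^ s) / ε := by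
        rw [hinv, mul_pow, show β * (s + 1) / L = s by rw [hβ]; field_simp]
        ring
    _ ≤ 3 * (μ * s * ((L : ℝ)⁻¹) ^ s) / ε := by gcongr
    _ = 3 * μ * s * ((L : ℝ)⁻¹) ^ s / ε := by ring

end FrameQuantization

theorem theorem1 :
    ∃ c₁ c₂ : ℝ, 0 < c₁ ∧ 0 < c₂ ∧
      ∀ (η : ℝ) (k m : ℕ), 0 < η → η ≤ 1 / 2 → 8 / η ≤ (k : ℝ) → 2 * k ≤ m →
        c₁ / η ^ 2 * Real.log ((m : ℝ) / k) ≤ (m : ℝ) / k →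
        ∃ (l : ℕ) (μ : ℝ) (β δ : ℕ → ℝ),
          k ≤ l ∧ l ≤ m ∧ 0 < μ ∧ (∀ L : ℕ, 2 ≤ L → (β L, δ L) ∈ admissible μ L) ∧
          ∀ (Ω : Type*) [MeasurableSpace Ω] (P : Measure Ω) [IsProbabilityMeasure P]
            (E : Ω → Matrix (Fin m) (Fin k) ℝ), IsStandardGaussianFrame P E →
            ∃ S : Set Ω, MeasurableSet S ∧
              1 - Real.exp (-(c₂ * η ^ 2 * m)) ≤ P.real S ∧
              ∀ ω ∈ S,
                (∀ x ∈ unitBall k, ∀ i, |analyze (E ω) x i| ≤ μ) ∧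
                ∀ L : ℕ, 2 ≤ L →
                  analysisDistortion (E ω) L ≤
                    ENNReal.ofReal (√k * (L : ℝ) ^ (-((1 - η) * ((m : ℝ) / k)))) ∧
                  betaDual l (β L) (E ω) * E ω = 1 ∧
                  schemeDistortion (E ω) (betaQuantizer m l (β L) L (δ L))
                      (betaDual l (β L) (E ω)) (unitBall k) ≤
                    ENNReal.ofReal (√k * (L : ℝ) ^ (-((1 - η) * ((m : ℝ) / k)))) := by
  refine ⟨1000, 1 / 128, by norm_num, by norm_num, fun η k m hη hη' hk hkm hc => ?_⟩
  obtain ⟨hkl, hl2, hlm⟩ := numBlocks_bounds hη hη' hk hkm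
  have hk16 := sixteen_le_of_eight_div_le hη hη' hk
  have hρ2 := two_le_ratio hη hη' hk hkm
  have hηρ := le_eta_sq_mul_ratio hη hη' hk hkm hc
  have hs := ratio_le_blockLength hη hη' hk hkm hc
  have hk0 : 0 < k := by
    have : (0 : ℝ) < k := by linarith
    exact_mod_cast this
  have hbound := fun L => reconstruction_error_le hη hη' hk hkm hc (L := L)
  have hsmall := fun L => small_singular_value_probability_le hη hη' hk hkm hc (L := L)
  have hfail := failure_probability_le hη hη' hk hkm hc
  set l := numBlocks η k
  set s := m / l with hsdef
  set ρ := (m : ℝ) / k with hρ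
  have hl0 : 0 < l := hk0.trans_le hkl
  have hm0 : 0 < m := hl0.trans_le hlm
  have hs2 : 2 ≤ s := by
    have h1 : (2 : ℝ) ≤ s := by nlinarith
    exact_mod_cast h1
  have hμ0 : 0 < 8 * √(m : ℝ) := by
    have := Real.sqrt_pos.2 (Nat.cast_pos.2 hm0 : (0 : ℝ) < m)
    positivity
  refine ⟨l, 8 * √m, fun L => L * s / (s + 1), fun L => 8 * √m * (s + 1) / L, hkl, hlm, hμ0,
    fun L hL => mem_admissible hs2 hL hμ0, fun Ω _ P _ E hE => ?_⟩
  -- `W` depends on `L` through `β`, which forces a union bound over `L`; for `L < 2` a dummy value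
  -- is used.
  have hW : ∀ L : ℕ, ∃ W : Matrix (Fin l) (Fin m) ℝ, 2 ≤ L → W * W.transpose = 1 ∧
      ∀ y : Fin m → ℝ, (L * s / (s + 1) : ℝ)⁻¹ *
        ‖(WithLp.toLp 2 (W.mulVec y) : EuclideanSpace ℝ (Fin l))‖ ≤
        ‖(WithLp.toLp 2 ((betaCondensation m (m / l) l (L * s / (s + 1))).mulVec y) :
          EuclideanSpace ℝ (Fin l))‖ := by
    intro L
    by_cases hL : 2 ≤ L
    · obtain ⟨W, hW⟩ := exists_rowNormalized_betaCondensation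
        (one_pos.trans (mem_admissible hs2 hL hμ0).1) hl0 hlm
      exact ⟨W, fun _ => hW⟩
    · exact ⟨0, fun h => absurd h hL⟩
  choose W hW using hW
  set ε : ℕ → ℝ := fun L => (L : ℝ) ^ (-(η * ρ / 4)) with hε
  set A : Set Ω := {ω | ∀ x : EuclideanSpace ℝ (Fin k), ‖(WithLp.toLp 2 ((E ω).mulVec x.ofLp) :
    EuclideanSpace ℝ (Fin m))‖ ≤ 8 * √m * ‖x‖} with hA
  -- Requiring `ω ∈ A` makes the failure of the norm bound on `E` count only once, not for every
  -- `L`; requiring `2 ≤ L` empties the irrelevant terms.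
  set B : ℕ → Set Ω := fun L => {ω | 2 ≤ L ∧ ω ∈ A ∧ ¬ ∀ x : EuclideanSpace ℝ (Fin k),
    ε L * √l * ‖x‖ ≤ ‖(WithLp.toLp 2 ((W L).mulVec ((E ω).mulVec x.ofLp)) :
      EuclideanSpace ℝ (Fin l))‖} with hB
  have hPB : ∀ L : ℕ, 2 ≤ L → P (B L) ≤ ENNReal.ofReal ((L : ℝ) ^ (-(η ^ 2 * m / 32))) := by
    intro L hL
    have hL1 : (1 : ℝ) ≤ L := by exact_mod_cast (by omega : 1 ≤ L)
    have hε0 : 0 < ε L := Real.rpow_pos_of_pos (by linarith) _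
    have hε1 : ε L ≤ 1 := Real.rpow_le_one_of_one_le_of_nonpos hL1 (by
      have : 0 ≤ η * ρ / 4 := by positivity
      linarith)
    have hM : ε L * √l ≤ 8 * √m := by
      have h1 : √(l : ℝ) ≤ √m := Real.sqrt_le_sqrt (by exact_mod_cast hlm)
      have h2 : ε L * √l ≤ 1 * √m := by gcongr
      linarith [Real.sqrt_nonneg (m : ℝ)]
    refine (measure_mono fun ω hω => hω.2).trans
      ((hE.measure_not_le_norm_mulVec_le (hW L hL).1 hε0 hl0 hM).trans
        (ENNReal.ofReal_le_ofReal (hsmall L hL)))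
  have hPB0 : ∀ L < 2, P (B L) = 0 := by
    intro L hL
    have : B L = ∅ := Set.eq_empty_of_forall_notMem fun ω hω => absurd hω.1 (by omega)
    rw [this, measure_empty]
  have hp : 2 ≤ η ^ 2 * m / 32 := by
    have h1 : η ^ 2 * m = η ^ 2 * ρ * k := by rw [hρ]; field_simp
    rw [h1]
    nlinarith
  have hbad : P (Aᶜ ∪ ⋃ L, B L) ≤ ENNReal.ofReal (Real.exp (-(1 / 128 * η ^ 2 * m))) := by
    refine (measure_union_le _ _).trans ((add_le_add hE.measure_not_norm_mulVec_le
      ((measure_iUnion_le _).trans (tsum_ofReal_rpow_neg_le hp hPB0 hPB))).trans ?_)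
    rw [← ENNReal.ofReal_add (by positivity) (by positivity)]
    exact ENNReal.ofReal_le_ofReal hfail
  refine ⟨(toMeasurable P (Aᶜ ∪ ⋃ L, B L))ᶜ, (measurableSet_toMeasurable _ _).compl,
    one_sub_le_measureReal_compl_toMeasurable (Real.exp_pos _).le hbad, fun ω hω => ?_⟩
  have hω' : ω ∉ Aᶜ ∪ ⋃ L, B L := fun h => hω (subset_toMeasurable _ _ h)
  rw [Set.mem_union, not_or, Set.mem_iUnion, not_exists, Set.notMem_compl_iff] at hω'
  obtain ⟨hωA, hωB⟩ := hω'
  have hμ : ∀ x ∈ unitBall k, ∀ i, |analyze (E ω) x i| ≤ 8 * √m := by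
    intro x hx i
    rw [unitBall, mem_closedBall_zero_iff] at hx
    have h1 := PiLp.norm_apply_le (WithLp.toLp 2 ((E ω).mulVec x.ofLp) :
      EuclideanSpace ℝ (Fin m)) i
    exact h1.trans ((hωA x).trans (mul_le_of_le_one_right hμ0.le hx))
  refine ⟨hμ, fun L hL => ?_⟩
  have hL0 : (0 : ℝ) < L := by exact_mod_cast (by omega : 0 < L)
  have hWE : ∀ x : EuclideanSpace ℝ (Fin k), ε L * √l * ‖x‖ ≤
      ‖(WithLp.toLp 2 ((W L).mulVec ((E ω).mulVec x.ofLp)) : EuclideanSpace ℝ (Fin l))‖ := by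
    by_contra h
    exact hωB L ⟨hL, hωA, h⟩
  have hε0 : 0 < ε L := Real.rpow_pos_of_pos hL0 _
  obtain ⟨hdual, hdist⟩ := schemeDistortion_le_of_singular_values hl0 hlm hs2 hL hε0 hμ0 hμ rfl
    (hW L hL).2 hWE
  have hdist' := hdist.trans (ENNReal.ofReal_le_ofReal (q := √k * (L : ℝ) ^ (-((1 - η) * ρ))) (by
    rw [div_le_iff₀ hε0]
    have := hbound L hL
    linarith))
  exact ⟨(analysisDistortion_le_schemeDistortion (by omega)
    (mem_admissible hs2 hL hμ0).2.1 hdual).trans hdist', hdual, hdist'⟩
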